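/- Let $\mathbf{k}$ be a field of characteristic $0$, and let $\Lambda$ be a complete local Noetherian $\mathbf{k}$-algebra with residue field $\mathbf{k}$ and maximal ideal $\mathfrak{m}_\Lambda$. Let $\mathbf{Art}_\Lambda$ be the category of Artinian local $\Lambda$-algebras with residue field $\mathbf{k}$, and write $A_0 = \Lambda/\mathfrak{m}_\Lambda = \mathbf{k}$. A functor $F : \mathbf{Art}_\Lambda \to \mathbf{Set}$ is *unobstructed* if $F(B') \to F(B)$ is surjective for every surjection $B' \to B$ in $\mathbf{Art}_\Lambda$. A *$\Lambda$-linear curved Batalin–Vilkovisky algebra* of dimension $d \ge 1$ is a tuple $(G^{\bullet,\bullet}, \wedge, 1, [-,-], \Delta, \bar\partial, \ell, y)$ consisting of flat, $\mathfrak{m}_\Lambda$-adically complete $\Lambda$-modules $G^{p,q}$ ($-d \le p \le 0$, $q \ge 0$; all other $G^{p,q}$ are $0$), $\Lambda$-bilinear maps $\wedge : G^{p,q} \times G^{p',q'} \to G^{p+p',q+q'}$ and $[-,-] : G^{p,q} \times G^{p',q'} \to G^{p+p'+1,q+q'}$, an element $1 \in G^{0,0}$, $\Lambda$-linear maps $\Delta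 : G^{p,q} \to G^{p+1,q}$ and $\bar\partial : G^{p,q} \to G^{p,q+1}$, and elements $\ell \in \mathfrak{m}_\Lambda G^{-1,2}$, $y \in \mathfrak{m}_\Lambda G^{0,1}$, such that, with $|\theta| = p+q$ for $\theta \in G^{p,q}$: * $\wedge$ is associative with unit $1$, and $\theta\wedge\xi = (-1)^{|\theta||\xi|}\xi\wedge\theta$; * $[\theta,\xi] = -(-1)^{(|\theta|+1)(|\xi|+1)}[\xi,\theta]$, $[\theta,[\xi,\eta]] = [[\theta,\xi],\eta] + (-1)^{(|\theta|+1)(|\xi|+1)}[\xi,[\theta,\eta]]$, and $[\theta,\xi\wedge\eta] = [\theta,\xi]\wedge\eta + (-1)^{(|\theta|+1)|\xi|}\xi\wedge[\theta,\eta]$; * $\Delta^2 = 0$ and $\Delta(\theta\wedge\xi) = \Delta(\theta)\wedge\xi + (-1)^{|\theta|}\theta\wedge\Delta(\xi) + (-1)^{|\theta|}[\theta,\xi]$; * $\bar\partial(\theta\wedge\xi) = \bar\partial\theta\wedge\xi + (-1)^{|\theta|}\theta\wedge\bar\partial\xi$ and $\bar\partial[\theta,\xi] = [\bar\partial\theta,\xi]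 + (-1)^{|\theta|+1}[\theta,\bar\partial\xi]$; * $\bar\partial^2\theta = [\ell,\theta]$, $\Delta\bar\partial\theta + \bar\partial\Delta\theta = [y,\theta]$, $\bar\partial\ell = 0$, $\bar\partial y + \Delta\ell = 0$. For $A \in \mathbf{Art}_\Lambda$ put $G_A^{p,q} = G^{p,q}\otimes_\Lambda A$, $G_A^n = \bigoplus_{p+q=n} G_A^{p,q}$, $G_0 = G_{A_0}$, and $\check d = \Delta + \bar\partial + (\ell+y)\wedge(-)$, which is a differential on $G_A^\bullet$. Let $'\!E_{0;r}$ be the spectral sequence of the double complex $(G_0^{\bullet,\bullet},\Delta,\bar\partial)$ filtered by the first degree. The algebra $G^{\bullet,\bullet}$ is * *quasi-perfect* if $'\!E_{0;r}$ degenerates at $E_1$ (all $d_r$ with $r \ge 1$ vanish), and $H^n(G_A^\bullet,\check d) \to H^n(G_0^\bullet,\check d)$ is surjective for every $n$ and every $A \in \mathbf{Art}_\Lambda$; * *semi-perfect* if all differentials $d_r$, $r \ge 1$, of $'\!E_{0;r}$ which start in total degree $0$ vanish, and $H^0(G_A^\bullet,\check d) \to H^0(G_0^\bullet,\check d)$ is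 surjective for every $A \in \mathbf{Art}_\Lambda$. The *semi-classical Maurer–Cartan functor* $\mathrm{SMC}(G^{\bullet,\bullet},-) : \mathbf{Art}_\Lambda \to \mathbf{Set}$ sends $A$ to the set of pairs $(\phi,f)$ with $\phi \in \mathfrak{m}_A G_A^{-1,1}$, $f \in \mathfrak{m}_A G_A^{0,0}$ and $$\bar\partial\phi + \tfrac12[\phi,\phi] + \ell = 0, \qquad \bar\partial f + [\phi,f] + y + \Delta\phi = 0.$$ **Theorem** (First abstract unobstructedness theorem). Let $G^{\bullet,\bullet}$ be a $\Lambda$-linear curved Batalin–Vilkovisky algebra. If $G^{\bullet,\bullet}$ is quasi-perfect, then $\mathrm{SMC}(G^{\bullet,\bullet},-)$ is unobstructed. Moreover, quasi-perfectness implies semi-perfectness, and semi-perfectness already implies that $\mathrm{SMC}(G^{\bullet,\bullet},-)$ is unobstructed. -/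

import Mathlib

open scoped TensorProduct

universe u v w

namespace BVUnobstructed

noncomputable section

/-! ### Artinian local algebras and functors of Artin rings -/

/-- An object of the category `Art_Λ`: an Artinian local `Λ`-algebra with the same residue field as
`Λ`. Surjectivity of `Λ → A / 𝔪_A` means that the kernel is `𝔪_Λ`, so that the structure map is
local and `Λ / 𝔪_Λ = A / 𝔪_A`. (Such an `A` is a finite `Λ`-module, so nothing is lost by taking
it in the universe of `Λ`.) -/
structure ArtAlg (Λ : Type u) [CommRing Λ] : Type (u + 1) where
  carrier : Type u
  [commRing : CommRing carrier]
  [algebra : Algebra Λ carrier]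
  [isLocalRing : IsLocalRing carrier]
  [isArtinianRing : IsArtinianRing carrier]
  residue_surjective :
    Function.Surjective (algebraMap Λ (IsLocalRing.ResidueField carrier))

instance (Λ : Type u) [CommRing Λ] : CoeSort (ArtAlg Λ) (Type u) := ⟨ArtAlg.carrier⟩

attribute [instance] ArtAlg.commRing ArtAlg.algebra ArtAlg.isLocalRing ArtAlg.isArtinianRing

/-- Morphisms of `Art_Λ`: homomorphisms of `Λ`-algebras (they are automatically local, because the
maximal ideal of an Artinian local ring is nilpotent). -/
@[ext]
structure ArtAlg.Hom {Λ : Type u} [CommRing Λ] (A B : ArtAlg Λ) : Type u where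
  toAlgHom : A →ₐ[Λ] B

instance (Λ : Type u) [CommRing Λ] : CategoryTheory.Category.{u} (ArtAlg Λ) where
  Hom A B := ArtAlg.Hom A B
  id A := ⟨AlgHom.id Λ A⟩
  comp f g := ⟨g.toAlgHom.comp f.toAlgHom⟩

/-- The object `A₀ = Λ / 𝔪_Λ` of `Art_Λ`. -/
def ArtAlg.A₀ (Λ : Type u) [CommRing Λ] [IsLocalRing Λ] : ArtAlg Λ where
  carrier := IsLocalRing.ResidueField Λ
  residue_surjective := by
    intro z
    obtain ⟨b, rfl⟩ := IsLocalRing.residue_surjective z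
    obtain ⟨c, rfl⟩ := IsLocalRing.residue_surjective b
    exact ⟨c, rfl⟩

/-- The canonical morphism `A → A / 𝔪_A = Λ / 𝔪_Λ = A₀` of `Art_Λ`. -/
def ArtAlg.toA₀ {Λ : Type u} [CommRing Λ] [IsLocalRing Λ] (A : ArtAlg Λ) :
    A ⟶ ArtAlg.A₀ Λ :=
  have hker : RingHom.ker (Algebra.ofId Λ (IsLocalRing.ResidueField A)) =
      IsLocalRing.maximalIdeal Λ :=
    IsLocalRing.eq_maximalIdeal
      (RingHom.ker_isMaximal_of_surjective
        (algebraMap Λ (IsLocalRing.ResidueField A)) A.residue_surjective)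
  let e : (Λ ⧸ IsLocalRing.maximalIdeal Λ) ≃ₐ[Λ] IsLocalRing.ResidueField A :=
    (Ideal.quotientEquivAlgOfEq Λ hker.symm).trans
      (Ideal.quotientKerAlgEquivOfSurjective
        (f := Algebra.ofId Λ (IsLocalRing.ResidueField A)) A.residue_surjective)
  ⟨(e.symm : IsLocalRing.ResidueField A →ₐ[Λ] (Λ ⧸ IsLocalRing.maximalIdeal Λ)).comp
    (IsScalarTower.toAlgHom Λ A (IsLocalRing.ResidueField A))⟩

/-- A functor on `Art_Λ` is unobstructed if it maps surjections to surjections. -/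
def Unobstructed {Λ : Type u} [CommRing Λ] (F : CategoryTheory.Functor (ArtAlg Λ) (Type v)) :
    Prop :=
  ∀ ⦃B' B : ArtAlg Λ⦄ (f : B' ⟶ B), Function.Surjective f.toAlgHom →
    Function.Surjective (F.map f)

/-! ### Total degree, cohomology, and the spectral sequence of a double complex

A bigraded module is given by its total module `C` and the submodules `K p q` of elements of
bidegree `(p, q)`; a differential is an endomorphism of `C`. -/

section Bigraded

variable {R : Type u} [CommRing R] {C : Type v} [AddCommGroup C] [Module R C]

/-- The part `⨁_{a + b = n} K a b` of total degree `n`. -/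
def tot (K : ℤ → ℤ → Submodule R C) (n : ℤ) : Submodule R C := ⨆ a : ℤ, K a (n - a)

/-- The part `F^p C^n = ⨁_{a + b = n, a ≥ p} K a b` of the filtration by the first degree. -/
def filt (K : ℤ → ℤ → Submodule R C) (p n : ℤ) : Submodule R C :=
  ⨆ a : ℤ, ⨆ _ : p ≤ a, K a (n - a)

/-- The cocycles of total degree `n`. -/
def cocycles (K : ℤ → ℤ → Submodule R C) (D : C →ₗ[R] C) (n : ℤ) : Submodule R C :=
  tot K n ⊓ LinearMap.ker D

/-- The coboundaries of total degree `n`. -/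
def coboundaries (K : ℤ → ℤ → Submodule R C) (D : C →ₗ[R] C) (n : ℤ) : Submodule R C :=
  (tot K (n - 1)).map D

/-- The cohomology `H^n` of the total complex. -/
abbrev Cohomology (K : ℤ → ℤ → Submodule R C) (D : C →ₗ[R] C) (n : ℤ) : Type v :=
  cocycles K D n ⧸ (coboundaries K D n).submoduleOf (cocycles K D n)

/-- `Z_r^{p} = {x ∈ F^p C^n | D x ∈ F^{p+r} C^{n+1}}`. -/
def ssZ (K : ℤ → ℤ → Submodule R C) (D : C →ₗ[R] C) (r p n : ℤ) : Submodule R C :=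
  filt K p n ⊓ (filt K (p + r) (n + 1)).comap D

/-- `Z_{r-1}^{p+1} + D Z_{r-1}^{p-r+1}` in total degree `n`. -/
def ssB (K : ℤ → ℤ → Submodule R C) (D : C →ₗ[R] C) (r p n : ℤ) : Submodule R C :=
  ssZ K D (r - 1) (p + 1) n ⊔ (ssZ K D (r - 1) (p - r + 1) (n - 1)).map D

/-- The term `E_r^{p, n-p}` (for `r ≥ 1`) of the spectral sequence of the filtration by the first
degree. -/
abbrev ssE (K : ℤ → ℤ → Submodule R C) (D : C →ₗ[R] C) (r p n : ℤ) : Type v :=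
  ssZ K D r p n ⧸ (ssB K D r p n).submoduleOf (ssZ K D r p n)

theorem ssZ_le_comap (K : ℤ → ℤ → Submodule R C) (D : C →ₗ[R] C) (hD : ∀ x, D (D x) = 0)
    (r p n : ℤ) : ∀ x ∈ ssZ K D r p n, D x ∈ ssZ K D r (p + r) (n + 1) := by
  intro x hx
  refine ⟨hx.2, ?_⟩
  simp [hD]

theorem ssB_map_mem (K : ℤ → ℤ → Submodule R C) (D : C →ₗ[R] C) (hD : ∀ x, D (D x) = 0)
    (r p n : ℤ) : ∀ x ∈ ssB K D r p n, D x ∈ ssB K D r (p + r) (n + 1) := by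
  intro x hx
  obtain ⟨y, hy, z, hz, rfl⟩ := Submodule.mem_sup.1 hx
  obtain ⟨t, -, rfl⟩ := hz
  rw [map_add, hD, add_zero]
  refine Submodule.mem_sup_right ⟨y, ?_, rfl⟩
  have e1 : p + r - r + 1 = p + 1 := by ring
  have e2 : n + 1 - 1 = n := by ring
  rw [e1, e2]
  exact hy

/-- The differential `d_r : E_r^{p, q} → E_r^{p+r, q-r+1}` (where `n = p + q`), induced by `D`. -/
def ssd (K : ℤ → ℤ → Submodule R C) (D : C →ₗ[R] C) (hD : ∀ x, D (D x) = 0) (r p n : ℤ) :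
    ssE K D r p n →ₗ[R] ssE K D r (p + r) (n + 1) :=
  Submodule.mapQ _ _ (D.restrict (ssZ_le_comap K D hD r p n))
    (fun x hx => ssB_map_mem K D hD r p n x.1 hx)

/-- All differentials `d_r`, `r ≥ 1`, leaving the terms of total degree `n` vanish. -/
def DegeneratesFrom (K : ℤ → ℤ → Submodule R C) (D : C →ₗ[R] C) (hD : ∀ x, D (D x) = 0)
    (n : ℤ) : Prop :=
  ∀ r : ℤ, 1 ≤ r → ∀ p : ℤ, ssd K D hD r p n = 0

/-- The first spectral sequence degenerates at `E₁`: all `d_r` with `r ≥ 1` vanish. -/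
def DegeneratesAtE₁ (K : ℤ → ℤ → Submodule R C) (D : C →ₗ[R] C) (hD : ∀ x, D (D x) = 0) : Prop :=
  ∀ n : ℤ, DegeneratesFrom K D hD n

end Bigraded

theorem rTensor_lTensor {Λ : Type u} [CommRing Λ] {M : Type w} [AddCommGroup M]
    [Module Λ M] (D : M →ₗ[Λ] M) {A B : Type u} [CommRing A] [Algebra Λ A]
    [CommRing B] [Algebra Λ B] (f : A →ₐ[Λ] B) (x : A ⊗[Λ] M) :
    f.toLinearMap.rTensor M (D.lTensor A x) = D.lTensor B (f.toLinearMap.rTensor M x) := by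
  rw [← LinearMap.comp_apply, ← LinearMap.comp_apply, LinearMap.rTensor_comp_lTensor,
    LinearMap.lTensor_comp_rTensor]

/-! ### Curved Batalin–Vilkovisky algebras -/

/-- A `Λ`-linear curved Batalin–Vilkovisky algebra of dimension `d`, given by its total module `M`
and the submodules `G p q` of elements of bidegree `(p, q)`. Signs are governed by the total degree
`p + q`. The compatibility `Δ [a, b] = [Δ a, b] + (-1)^{|a|+1} [a, Δ b]` follows from `Δ_wedge` and `Δ_Δ`. -/
structure CurvedBVAlgebra (Λ : Type u) [CommRing Λ] [IsLocalRing Λ] (d : ℕ)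
    (M : Type w) [AddCommGroup M] [Module Λ M] where
  /-- The part `G^{p,q}`. -/
  G : ℤ → ℤ → Submodule Λ M
  isInternal : DirectSum.IsInternal (fun pq : ℤ × ℤ => G pq.1 pq.2)
  eq_bot : ∀ p q : ℤ, (p < -(d : ℤ) ∨ 0 < p ∨ q < 0) → G p q = ⊥
  flat : ∀ p q : ℤ, Module.Flat Λ (G p q)
  complete : ∀ p q : ℤ, IsAdicComplete (IsLocalRing.maximalIdeal Λ) (G p q)
  /-- The product. -/
  wedge : M →ₗ[Λ] M →ₗ[Λ] M
  /-- The unit. -/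
  one : M
  /-- The Lie bracket. -/
  bracket : M →ₗ[Λ] M →ₗ[Λ] M
  /-- The Batalin–Vilkovisky operator. -/
  Δ : M →ₗ[Λ] M
  /-- The predifferential. -/
  dbar : M →ₗ[Λ] M
  /-- The curvature. -/
  ℓ : M
  /-- The element measuring the failure of `Δ` and `dbar` to anticommute. -/
  y : M
  one_mem : one ∈ G 0 0
  wedge_mem : ∀ p q p' q' : ℤ, ∀ a ∈ G p q, ∀ b ∈ G p' q', wedge a b ∈ G (p + p') (q + q')
  bracket_mem : ∀ p q p' q' : ℤ, ∀ a ∈ G p q, ∀ b ∈ G p' q',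
    bracket a b ∈ G (p + p' + 1) (q + q')
  Δ_mem : ∀ p q : ℤ, ∀ a ∈ G p q, Δ a ∈ G (p + 1) q
  dbar_mem : ∀ p q : ℤ, ∀ a ∈ G p q, dbar a ∈ G p (q + 1)
  ℓ_mem : ℓ ∈ IsLocalRing.maximalIdeal Λ • G (-1) 2
  y_mem : y ∈ IsLocalRing.maximalIdeal Λ • G 0 1
  wedge_assoc : ∀ a b c : M, wedge (wedge a b) c = wedge a (wedge b c)
  one_wedge : ∀ a : M, wedge one a = a
  wedge_comm : ∀ p q p' q' : ℤ, ∀ a ∈ G p q, ∀ b ∈ G p' q',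
    wedge a b = ((p + q) * (p' + q')).negOnePow • wedge b a
  bracket_antisymm : ∀ p q p' q' : ℤ, ∀ a ∈ G p q, ∀ b ∈ G p' q',
    bracket a b = -(((p + q + 1) * (p' + q' + 1)).negOnePow • bracket b a)
  jacobi : ∀ p q p' q' : ℤ, ∀ a ∈ G p q, ∀ b ∈ G p' q', ∀ c : M,
    bracket a (bracket b c) =
      bracket (bracket a b) c + ((p + q + 1) * (p' + q' + 1)).negOnePow • bracket b (bracket a c)
  poisson : ∀ p q p' q' : ℤ, ∀ a ∈ G p q, ∀ b ∈ G p' q', ∀ c : M,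
    bracket a (wedge b c) =
      wedge (bracket a b) c + ((p + q + 1) * (p' + q')).negOnePow • wedge b (bracket a c)
  Δ_wedge : ∀ p q : ℤ, ∀ a ∈ G p q, ∀ b : M,
    Δ (wedge a b) =
      wedge (Δ a) b + (p + q).negOnePow • wedge a (Δ b) + (p + q).negOnePow • bracket a b
  Δ_Δ : ∀ a : M, Δ (Δ a) = 0
  dbar_wedge : ∀ p q : ℤ, ∀ a ∈ G p q, ∀ b : M,
    dbar (wedge a b) = wedge (dbar a) b + (p + q).negOnePow • wedge a (dbar b)
  dbar_bracket : ∀ p q : ℤ, ∀ a ∈ G p q, ∀ b : M,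
    dbar (bracket a b) = bracket (dbar a) b + (p + q + 1).negOnePow • bracket a (dbar b)
  dbar_dbar : ∀ a : M, dbar (dbar a) = bracket ℓ a
  Δ_dbar : ∀ a : M, Δ (dbar a) + dbar (Δ a) = bracket y a
  dbar_ℓ : dbar ℓ = 0
  dbar_y : dbar y + Δ ℓ = 0

namespace CurvedBVAlgebra

variable {Λ : Type u} [CommRing Λ] [IsLocalRing Λ] {d : ℕ} {M : Type w} [AddCommGroup M]
  [Module Λ M]

/-- The operator `ď = Δ + ∂̄ + (ℓ + y) ∧ (-)`. -/
def dcheck (G : CurvedBVAlgebra Λ d M) : M →ₗ[Λ] M := G.Δ + G.dbar + G.wedge (G.ℓ + G.y)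

theorem ℓ_mem' (G : CurvedBVAlgebra Λ d M) : G.ℓ ∈ G.G (-1) 2 :=
  Submodule.smul_le_right G.ℓ_mem

theorem y_mem' (G : CurvedBVAlgebra Λ d M) : G.y ∈ G.G 0 1 :=
  Submodule.smul_le_right G.y_mem

theorem Δ_y (G : CurvedBVAlgebra Λ d M) : G.Δ G.y = 0 := by
  have h := G.Δ_mem 0 1 _ G.y_mem'
  rw [G.eq_bot (0 + 1) 1 (by norm_num)] at h
  simpa using h

theorem add_add_apply (G : CurvedBVAlgebra Λ d M) (a : M) :
    (G.Δ + G.dbar) ((G.Δ + G.dbar) a) = G.bracket (G.ℓ + G.y) a := by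
  simp only [LinearMap.add_apply, map_add, G.Δ_Δ, G.dbar_dbar, ← G.Δ_dbar]
  abel

/-- `ď` is a differential. -/
theorem dcheck_dcheck (G : CurvedBVAlgebra Λ d M) (h2 : IsUnit (2 : Λ)) (a : M) :
    G.dcheck (G.dcheck a) = 0 := by
  have s1 : (-1 + 2 : ℤ).negOnePow = -1 := by decide
  have s2 : (0 + 1 : ℤ).negOnePow = -1 := by decide
  have c1 : G.wedge G.ℓ G.ℓ = -G.wedge G.ℓ G.ℓ := by
    have := G.wedge_comm (-1) 2 (-1) 2 _ G.ℓ_mem' _ G.ℓ_mem'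
    rwa [show ((-1 + 2) * (-1 + 2) : ℤ).negOnePow = -1 by decide, Units.neg_smul, one_smul] at this
  have c2 : G.wedge G.y G.y = -G.wedge G.y G.y := by
    have := G.wedge_comm 0 1 0 1 _ G.y_mem' _ G.y_mem'
    rwa [show ((0 + 1) * (0 + 1) : ℤ).negOnePow = -1 by decide, Units.neg_smul, one_smul] at this
  have c3 : G.wedge G.ℓ G.y = -G.wedge G.y G.ℓ := by
    have := G.wedge_comm (-1) 2 0 1 _ G.ℓ_mem' _ G.y_mem'
    rwa [show ((-1 + 2) * (0 + 1) : ℤ).negOnePow = -1 by decide, Units.neg_smul, one_smul] at this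
  have z : ∀ m : M, m = -m → m = 0 := by
    intro m hm
    have : (2 : Λ) • m = 0 := by
      rw [two_smul]; nth_rewrite 2 [hm]; exact add_neg_cancel m
    exact h2.smul_eq_zero.1 this
  have hLL : G.wedge (G.ℓ + G.y) (G.wedge (G.ℓ + G.y) a) = 0 := by
    rw [← G.wedge_assoc]
    have : G.wedge (G.ℓ + G.y) (G.ℓ + G.y) = 0 := by
      simp only [map_add, LinearMap.add_apply, z _ c1, z _ c2, c3]
      abel
    rw [this, map_zero, LinearMap.zero_apply]
  have hΔ : G.Δ (G.wedge (G.ℓ + G.y) a) =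
      G.wedge (G.Δ G.ℓ) a - G.wedge (G.ℓ + G.y) (G.Δ a) - G.bracket (G.ℓ + G.y) a := by
    simp only [map_add, LinearMap.add_apply, G.Δ_wedge (-1) 2 _ G.ℓ_mem',
      G.Δ_wedge 0 1 _ G.y_mem', s1, s2, Units.neg_smul, one_smul, G.Δ_y, map_zero,
      LinearMap.zero_apply]
    abel
  have hd : G.dbar (G.wedge (G.ℓ + G.y) a) =
      G.wedge (G.dbar G.y) a - G.wedge (G.ℓ + G.y) (G.dbar a) := by
    simp only [map_add, LinearMap.add_apply, G.dbar_wedge (-1) 2 _ G.ℓ_mem',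
      G.dbar_wedge 0 1 _ G.y_mem', s1, s2, Units.neg_smul, one_smul, G.dbar_ℓ, map_zero,
      LinearMap.zero_apply]
    abel
  have hy : G.wedge (G.dbar G.y) a + G.wedge (G.Δ G.ℓ) a = 0 := by
    rw [← LinearMap.add_apply, ← map_add, G.dbar_y, map_zero, LinearMap.zero_apply]
  have hsq := G.add_add_apply a
  have e : G.dcheck (G.dcheck a) = (G.Δ + G.dbar) ((G.Δ + G.dbar) a)
      + (G.Δ (G.wedge (G.ℓ + G.y) a) + G.dbar (G.wedge (G.ℓ + G.y) a)
      + G.wedge (G.ℓ + G.y) (G.Δ a) + G.wedge (G.ℓ + G.y) (G.dbar a)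
      + G.wedge (G.ℓ + G.y) (G.wedge (G.ℓ + G.y) a)) := by
    simp only [dcheck, LinearMap.add_apply, map_add]
    abel
  rw [e, hsq, hLL, hΔ, hd]
  refine Eq.trans ?_ hy
  abel

/-! #### Base change -/

/-- The part `G_A^{p,q} = A ⊗ G^{p,q}` of `A ⊗ M`, as an `A`-submodule. -/
def GA (G : CurvedBVAlgebra Λ d M) (A : Type u) [CommRing A] [Algebra Λ A] (p q : ℤ) :
    Submodule A (A ⊗[Λ] M) :=
  (G.G p q).baseChange A

/-- The same part, as a `Λ`-submodule. -/
def GΛ (G : CurvedBVAlgebra Λ d M) (A : Type u) [CommRing A] [Algebra Λ A] (p q : ℤ) :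
    Submodule Λ (A ⊗[Λ] M) :=
  (G.GA A p q).restrictScalars Λ

theorem map_mem_GΛ (G : CurvedBVAlgebra Λ d M) {A B : Type u} [CommRing A] [Algebra Λ A]
    [CommRing B] [Algebra Λ B] (f : A →ₐ[Λ] B) (p q : ℤ) :
    G.GΛ A p q ≤ (G.GΛ B p q).comap (f.toLinearMap.rTensor M) := by
  intro x hx
  obtain ⟨t, rfl⟩ := Submodule.toBaseChange_surjective' A (G.G p q) hx
  change f.toLinearMap.rTensor M _ ∈ (G.G p q).baseChange B
  induction t with
  | zero => simp
  | tmul a m =>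
    rw [Submodule.coe_toBaseChange_tmul, LinearMap.rTensor_tmul]
    exact Submodule.tmul_mem_baseChange_of_mem _ m.2
  | add s t hs ht =>
    rw [map_add, Submodule.coe_add, map_add]
    exact add_mem (hs (Subtype.prop _)) (ht (Subtype.prop _))

theorem map_mem_maximalIdeal_smul (G : CurvedBVAlgebra Λ d M) {A B : Type u} [CommRing A]
    [Algebra Λ A] [CommRing B] [Algebra Λ B] (f : A →ₐ[Λ] B) {I : Ideal A} {J : Ideal B}
    (hf : I ≤ J.comap f) {p q : ℤ} {x : A ⊗[Λ] M} (hx : x ∈ I • G.GA A p q) :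
    f.toLinearMap.rTensor M x ∈ J • G.GA B p q := by
  refine Submodule.smul_induction_on hx ?_ ?_
  · intro a ha m hm
    have e : f.toLinearMap.rTensor M (a • m) = f a • f.toLinearMap.rTensor M m := by
      clear hm
      induction m with
      | zero => simp
      | tmul b m => simp [TensorProduct.smul_tmul']
      | add s t hs ht => simp only [smul_add, map_add, hs, ht]
    rw [e]
    exact Submodule.smul_mem_smul (hf ha) (G.map_mem_GΛ f p q hm)
  · intro s t hs ht
    rw [map_add]
    exact add_mem hs ht

theorem map_mem_tot (G : CurvedBVAlgebra Λ d M) {A B : Type u} [CommRing A] [Algebra Λ A]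
    [CommRing B] [Algebra Λ B] (f : A →ₐ[Λ] B) (n : ℤ) :
    tot (G.GΛ A) n ≤ (tot (G.GΛ B) n).comap (f.toLinearMap.rTensor M) :=
  iSup_le fun a => (G.map_mem_GΛ f a (n - a)).trans
    (Submodule.comap_mono (le_iSup (fun a => G.GΛ B a (n - a)) a))

/-- The base change `A ⊗ M → A ⊗ M` of `ď`. -/
def dcheckA (G : CurvedBVAlgebra Λ d M) (A : Type u) [CommRing A] [Algebra Λ A] :
    A ⊗[Λ] M →ₗ[Λ] A ⊗[Λ] M :=
  G.dcheck.lTensor A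

theorem map_dcheckA (G : CurvedBVAlgebra Λ d M) {A B : Type u} [CommRing A] [Algebra Λ A]
    [CommRing B] [Algebra Λ B] (f : A →ₐ[Λ] B) (x : A ⊗[Λ] M) :
    f.toLinearMap.rTensor M (G.dcheckA A x) = G.dcheckA B (f.toLinearMap.rTensor M x) := by
  induction x with
  | zero => simp
  | tmul a m => simp [dcheckA]
  | add s t hs ht => simp only [map_add, hs, ht]

/-- The cohomology `H^n(G_A^•, ď)`. -/
abbrev HA (G : CurvedBVAlgebra Λ d M) (A : Type u) [CommRing A] [Algebra Λ A] (n : ℤ) :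
    Type (max u w) :=
  Cohomology (G.GΛ A) (G.dcheckA A) n

theorem map_mem_cocycles (G : CurvedBVAlgebra Λ d M) {A B : Type u} [CommRing A] [Algebra Λ A]
    [CommRing B] [Algebra Λ B] (f : A →ₐ[Λ] B) (n : ℤ) :
    ∀ x ∈ cocycles (G.GΛ A) (G.dcheckA A) n,
      f.toLinearMap.rTensor M x ∈ cocycles (G.GΛ B) (G.dcheckA B) n := by
  rintro x ⟨hx, hx'⟩
  refine ⟨G.map_mem_tot f n hx, ?_⟩
  change G.dcheckA A x = 0 at hx'
  change G.dcheckA B _ = 0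
  rw [← map_dcheckA, hx', map_zero]

theorem map_mem_coboundaries (G : CurvedBVAlgebra Λ d M) {A B : Type u} [CommRing A] [Algebra Λ A]
    [CommRing B] [Algebra Λ B] (f : A →ₐ[Λ] B) (n : ℤ) :
    ∀ x ∈ coboundaries (G.GΛ A) (G.dcheckA A) n,
      f.toLinearMap.rTensor M x ∈ coboundaries (G.GΛ B) (G.dcheckA B) n := by
  rintro _ ⟨x, hx, rfl⟩
  exact ⟨_, G.map_mem_tot f (n - 1) hx, (G.map_dcheckA f x).symm⟩

/-- The induced map `H^n(G_A^•, ď) → H^n(G_B^•, ď)`. -/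
def mapHA (G : CurvedBVAlgebra Λ d M) {A B : Type u} [CommRing A] [Algebra Λ A]
    [CommRing B] [Algebra Λ B] (f : A →ₐ[Λ] B) (n : ℤ) : G.HA A n →ₗ[Λ] G.HA B n :=
  Submodule.mapQ _ _ ((f.toLinearMap.rTensor M).restrict (G.map_mem_cocycles f n))
    (fun x hx => G.map_mem_coboundaries f n x.1 hx)

/-! #### Quasi-perfectness and semi-perfectness -/

/-- The differential `Δ + ∂̄` of the total complex of the double complex `(G₀, Δ, ∂̄)`. -/
def d₀ (G : CurvedBVAlgebra Λ d M) :
    ArtAlg.A₀ Λ ⊗[Λ] M →ₗ[Λ] ArtAlg.A₀ Λ ⊗[Λ] M :=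
  (G.Δ + G.dbar).lTensor (ArtAlg.A₀ Λ)

theorem d₀_d₀ (G : CurvedBVAlgebra Λ d M) (x : ArtAlg.A₀ Λ ⊗[Λ] M) : G.d₀ (G.d₀ x) = 0 := by
  induction x with
  | zero => simp
  | add s t hs ht => simp only [map_add, hs, ht, add_zero]
  | tmul a m =>
    rw [d₀, LinearMap.lTensor_tmul, LinearMap.lTensor_tmul, G.add_add_apply]
    have key : ∀ p q : ℤ, ∀ z ∈ IsLocalRing.maximalIdeal Λ • G.G p q,
        a ⊗ₜ[Λ] G.bracket z m = 0 := by
      intro p q z hz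
      refine Submodule.smul_induction_on hz ?_ ?_
      · intro r hr t _
        have hr0 : r • a = 0 := by
          have : algebraMap Λ (IsLocalRing.ResidueField Λ) r = 0 :=
            Ideal.Quotient.eq_zero_iff_mem.2 hr
          change r • (show IsLocalRing.ResidueField Λ from a) = 0
          rw [Algebra.smul_def, this, zero_mul]
        rw [map_smul, LinearMap.smul_apply, ← TensorProduct.smul_tmul, hr0,
          TensorProduct.zero_tmul]
      · intro s t hs ht
        rw [map_add, LinearMap.add_apply, TensorProduct.tmul_add, hs, ht, add_zero]
    rw [map_add, LinearMap.add_apply, TensorProduct.tmul_add, key _ _ _ G.ℓ_mem,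
      key _ _ _ G.y_mem, add_zero]

/-- Quasi-perfectness: the first spectral sequence of `(G₀, Δ, ∂̄)` degenerates at `E₁`, and
`H^n(G_A^•, ď) → H^n(G₀^•, ď)` is surjective for all `n` and all `A` in `Art_Λ`. -/
structure IsQuasiPerfect (G : CurvedBVAlgebra Λ d M) : Prop where
  degenerates : DegeneratesAtE₁ (G.GΛ (ArtAlg.A₀ Λ)) G.d₀ G.d₀_d₀
  surjective : ∀ (A : ArtAlg Λ) (n : ℤ), Function.Surjective (G.mapHA A.toA₀.toAlgHom n)

/-- Semi-perfectness: quasi-perfectness in total degree `0` only. The differentials `d_r` (`r ≥ 1`)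
from total degree `0` to total degree `1` vanish in the first spectral sequence of `(G₀, Δ, ∂̄)`,
and `H^0(G_A^•, ď) → H^0(G₀^•, ď)` is surjective for all `A` in `Art_Λ`. -/
structure IsSemiPerfect (G : CurvedBVAlgebra Λ d M) : Prop where
  degenerates : DegeneratesFrom (G.GΛ (ArtAlg.A₀ Λ)) G.d₀ G.d₀_d₀ 0
  surjective : ∀ A : ArtAlg Λ, Function.Surjective (G.mapHA A.toA₀.toAlgHom 0)

/-! #### The semi-classical Maurer–Cartan functor -/

/-- The bracket of `A ⊗ M`. -/
def bracketA (G : CurvedBVAlgebra Λ d M) (A : Type u) [CommRing A] [Algebra Λ A] :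
    A ⊗[Λ] M →ₗ[A] A ⊗[Λ] M →ₗ[A] A ⊗[Λ] M :=
  LinearMap.BilinMap.baseChange A G.bracket

/-- The set of pairs `(φ, f)` with `φ ∈ 𝔪_A G_A^{-1,1}` and `f ∈ 𝔪_A G_A^{0,0}` satisfying the
semi-classical extended Maurer–Cartan equation. -/
def smcSet (k : Type v) [Field k] [Algebra k Λ] (G : CurvedBVAlgebra Λ d M)
    (A : Type u) [CommRing A] [Algebra Λ A] [IsLocalRing A] :
    Set ((A ⊗[Λ] M) × (A ⊗[Λ] M)) :=
  {x | x.1 ∈ IsLocalRing.maximalIdeal A • G.GA A (-1) 1 ∧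
    x.2 ∈ IsLocalRing.maximalIdeal A • G.GA A 0 0 ∧
    G.dbar.lTensor A x.1 + algebraMap k Λ (1 / 2) • G.bracketA A x.1 x.1 + 1 ⊗ₜ G.ℓ = 0 ∧
    G.dbar.lTensor A x.2 + G.bracketA A x.1 x.2 + 1 ⊗ₜ G.y + G.Δ.lTensor A x.1 = 0}

theorem map_bracketA (G : CurvedBVAlgebra Λ d M) {A B : Type u} [CommRing A] [Algebra Λ A]
    [CommRing B] [Algebra Λ B] (f : A →ₐ[Λ] B) (x z : A ⊗[Λ] M) :
    f.toLinearMap.rTensor M (G.bracketA A x z) =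
      G.bracketA B (f.toLinearMap.rTensor M x) (f.toLinearMap.rTensor M z) := by
  induction x with
  | zero => simp
  | add s t hs ht => simp only [map_add, LinearMap.add_apply, hs, ht]
  | tmul a m =>
    induction z with
    | zero => simp
    | add s t hs ht => simp only [map_add, hs, ht]
    | tmul b n => simp [bracketA]

theorem map_mem_smcSet (k : Type v) [Field k] [Algebra k Λ] (G : CurvedBVAlgebra Λ d M)
    {A B : ArtAlg Λ} (f : A ⟶ B) {x : (A ⊗[Λ] M) × (A ⊗[Λ] M)} (hx : x ∈ G.smcSet k A) :
    (f.toAlgHom.toLinearMap.rTensor M x.1, f.toAlgHom.toLinearMap.rTensor M x.2) ∈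
      G.smcSet k B := by
  have hf : IsLocalRing.maximalIdeal A ≤ (IsLocalRing.maximalIdeal B).comap f.toAlgHom := by
    intro a ha
    have hn : IsNilpotent a := by
      have := IsArtinianRing.isNilpotent_jacobson_bot (R := A)
      rw [IsLocalRing.jacobson_eq_maximalIdeal ⊥ bot_ne_top] at this
      obtain ⟨n, hn⟩ := this
      exact ⟨n, by simpa [hn] using Ideal.pow_mem_pow ha n⟩
    rw [Ideal.mem_comap, IsLocalRing.mem_maximalIdeal]
    exact (hn.map f.toAlgHom).not_isUnit
  obtain ⟨h1, h2, h3, h4⟩ := hx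
  refine ⟨G.map_mem_maximalIdeal_smul _ hf h1, G.map_mem_maximalIdeal_smul _ hf h2, ?_, ?_⟩
  · have := congrArg (f.toAlgHom.toLinearMap.rTensor M) h3
    simpa [rTensor_lTensor, map_bracketA] using this
  · have := congrArg (f.toAlgHom.toLinearMap.rTensor M) h4
    simpa [rTensor_lTensor, map_bracketA] using this

/-- The semi-classical Maurer–Cartan functor `SMC(G, -)` on `Art_Λ`. -/
def SMC (k : Type v) [Field k] [Algebra k Λ] (G : CurvedBVAlgebra Λ d M) :
    CategoryTheory.Functor (ArtAlg Λ) (Type (max u w)) where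
  obj A := G.smcSet k A
  map {_ _} f := TypeCat.ofHom fun x => ⟨_, G.map_mem_smcSet k f x.2⟩
  map_id A := by
    ext x
    · exact LinearMap.congr_fun (LinearMap.rTensor_id M A) x.1.1
    · exact LinearMap.congr_fun (LinearMap.rTensor_id M A) x.1.2
  map_comp f g := by
    ext x
    · exact LinearMap.congr_fun
        (LinearMap.rTensor_comp M g.toAlgHom.toLinearMap f.toAlgHom.toLinearMap) x.1.1
    · exact LinearMap.congr_fun
        (LinearMap.rTensor_comp M g.toAlgHom.toLinearMap f.toAlgHom.toLinearMap) x.1.2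

end CurvedBVAlgebra

end

end BVUnobstructed

namespace BVUnobstructed

/-! ### Ideals of colength one -/

/-- `J = K + (b)` where `b ∉ K` and `𝔪 b ⊆ K`; thus `J / K` is spanned by `b` over the residue
field. -/
structure IsSimpleStep {A : Type u} [CommRing A] [IsLocalRing A] (K J : Ideal A) (b : A) :
    Prop where
  notMem : b ∉ K
  eq_sup : J = K ⊔ Ideal.span {b}
  mul_mem : ∀ a ∈ IsLocalRing.maximalIdeal A, a * b ∈ K

namespace IsSimpleStep

variable {A : Type u} [CommRing A] [IsLocalRing A] {K J : Ideal A} {b : A}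

theorem le (h : IsSimpleStep K J b) : K ≤ J := h.eq_sup ▸ le_sup_left

theorem mem (h : IsSimpleStep K J b) : b ∈ J :=
  h.eq_sup ▸ Ideal.mem_sup_right (Ideal.mem_span_singleton_self b)

theorem lt (h : IsSimpleStep K J b) : K < J :=
  lt_of_le_of_ne h.le fun e => h.notMem (e ▸ h.mem)

theorem maximalIdeal_mul_le (h : IsSimpleStep K J b) : IsLocalRing.maximalIdeal A * J ≤ K := by
  rw [h.eq_sup, Ideal.mul_sup, sup_le_iff]
  refine ⟨Ideal.mul_le_right, Ideal.mul_le.2 fun a ha c hc => ?_⟩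
  obtain ⟨r, rfl⟩ := Ideal.mem_span_singleton'.1 hc
  rw [mul_left_comm]
  exact K.mul_mem_left _ (h.mul_mem a ha)

end IsSimpleStep

theorem exists_isSimpleStep {A : Type u} [CommRing A] [IsLocalRing A] [IsNoetherianRing A]
    {I J : Ideal A} (h : I < J) : ∃ K b, I ≤ K ∧ IsSimpleStep K J b := by
  obtain ⟨K, ⟨hIK, hKJ⟩, hmax⟩ :=
    (wellFounded_gt (α := Ideal A)).has_min {K | I ≤ K ∧ K < J} ⟨I, le_rfl, h⟩
  obtain ⟨b, hbJ, hbK⟩ := SetLike.exists_of_lt hKJ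
  have hsup : ∀ c ∈ J, c ∉ K → J = K ⊔ Ideal.span {c} := by
    intro c hc hcK
    have hle : K ⊔ Ideal.span {c} ≤ J :=
      sup_le hKJ.le ((Ideal.span_singleton_le_iff_mem J).2 hc)
    have hKc : K < K ⊔ Ideal.span {c} := lt_of_le_of_ne le_sup_left fun e =>
      hcK (e ▸ Ideal.mem_sup_right (Ideal.mem_span_singleton_self c))
    by_contra hne
    exact hmax _ ⟨hIK.trans le_sup_left, lt_of_le_of_ne hle (Ne.symm hne)⟩ hKc
  refine ⟨K, b, hIK, hbK, hsup b hbJ hbK, fun a ha => ?_⟩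
  by_contra hab
  have hb : b ∈ K ⊔ Ideal.span {a * b} := hsup _ (J.mul_mem_left a hbJ) hab ▸ hbJ
  obtain ⟨x, hx, z, hz, hxz⟩ := Submodule.mem_sup.1 hb
  obtain ⟨c, rfl⟩ := Ideal.mem_span_singleton'.1 hz
  have hu : IsUnit (1 - c * a) := by
    by_contra hn
    have := (IsLocalRing.maximalIdeal A).add_mem ((IsLocalRing.mem_maximalIdeal _).2 hn)
      ((IsLocalRing.maximalIdeal A).mul_mem_left c ha)
    rw [sub_add_cancel] at this
    exact (Ideal.ne_top_iff_one _).1 (IsLocalRing.maximalIdeal.isMaximal A).ne_top this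
  refine hbK ((Ideal.unit_mul_mem_iff_mem K hu).1 ?_)
  have : (1 - c * a) * b = x := by linear_combination -hxz
  rwa [this]

/-! ### Exponential series -/

/-- The terms `xⁿ / n!` of the exponential series, where `L` is the multiplication by `x` and
`c n = 1 / (n + 1)`. -/
def expTerm {R : Type u} [CommRing R] {V : Type v} [AddCommGroup V] [Module R V] (c : ℕ → R)
    (L : V →ₗ[R] V) (e : V) : ℕ → V
  | 0 => e
  | n + 1 => c n • L (expTerm c L e n)

section expTerm

variable {R : Type u} [CommRing R] {V : Type v} [AddCommGroup V] [Module R V] {c : ℕ → R}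

theorem expTerm_zero (L : V →ₗ[R] V) (e : V) : expTerm c L e 0 = e := rfl

theorem expTerm_succ (L : V →ₗ[R] V) (e : V) (n : ℕ) :
    expTerm c L e (n + 1) = c n • L (expTerm c L e n) := rfl

variable
  (hc : ∀ n : ℕ, ((n : R) + 1) * c n = 1) {L D T P Q : V →ₗ[R] V} {e : V}

include hc

theorem mul_expTerm (n : ℕ) : L (expTerm c L e n) = ((n : R) + 1) • expTerm c L e (n + 1) := by
  rw [expTerm_succ, smul_smul, hc, one_smul]

theorem bracket_expTerm (hT : ∀ v, T (L v) = Q v + L (T v)) (hLQ : ∀ v, L (Q v) = Q (L v))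
    (he : T e = 0) (n : ℕ) : T (expTerm c L e (n + 1)) = Q (expTerm c L e n) := by
  induction n with
  | zero =>
    have h0 : c 0 = 1 := by simpa using hc 0
    rw [expTerm_succ, map_smul, hT, expTerm_zero, he, map_zero, add_zero, h0, one_smul]
  | succ n ih =>
    rw [expTerm_succ, map_smul, hT, ih, hLQ, mul_expTerm hc, map_smul]
    have := hc (n + 1)
    push_cast at this
    nth_rewrite 1 [← one_smul R (Q (expTerm c L e (n + 1)))]
    rw [← add_smul, smul_smul]
    have e1 : c (n + 1) * (1 + ((n : R) + 1)) = 1 := by linear_combination this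
    rw [e1, one_smul]

theorem derivation_expTerm (hD : ∀ v, D (L v) = P v + L (D v) + T v)
    (hT : ∀ v, T (L v) = Q v + L (T v)) (hLP : ∀ v, L (P v) = P (L v))
    (hLQ : ∀ v, L (Q v) = Q (L v)) (hTe : T e = 0) (hDe : D e = 0) (n : ℕ) :
    D (expTerm c L e (n + 2)) = P (expTerm c L e (n + 1)) + c 1 • Q (expTerm c L e n) := by
  have h0 : c 0 = 1 := by simpa using hc 0
  have h1 : D (expTerm c L e 1) = P e := by
    rw [← zero_add 1, expTerm_succ, expTerm_zero, map_smul, hD, hTe, hDe, map_zero, add_zero,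
      add_zero, h0, one_smul]
  have hT' := bracket_expTerm hc hT hLQ hTe
  induction n with
  | zero =>
    have h2 := hc 1
    rw [expTerm_succ, map_smul, hD, h1, hLP, hT' 0]
    have e2 : L e = expTerm c L e 1 := by
      rw [← zero_add 1, expTerm_succ, h0, one_smul, expTerm_zero]
    rw [e2, smul_add, expTerm_zero]
    congr 1
    rw [← two_smul R, smul_smul]
    have e1 : c 1 * 2 = 1 := by push_cast at h2; linear_combination h2
    rw [zero_add, e1, one_smul]
  | succ n ih =>
    rw [expTerm_succ, map_smul, hD, ih, hT', map_add, map_smul, hLP, hLQ, mul_expTerm hc,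
      mul_expTerm hc, map_smul, map_smul]
    have h2 := hc 1
    have h3 := hc (n + 2)
    push_cast at h2 h3 ⊢
    have e1 : c (n + 2) * (1 + (n + 1 + 1)) = 1 := by linear_combination h3
    have e2 : c (n + 2) * (c 1 * (n + 1) + 1) = c 1 := by
      linear_combination c 1 * h3 - c (n + 2) * h2
    have key : ∀ x z : V, c (n + 2) • (x + (((n : R) + 1 + 1) • x + c 1 • ((n : R) + 1) • z) + z)
        = (c (n + 2) * (1 + (n + 1 + 1))) • x + (c (n + 2) * (c 1 * (n + 1) + 1)) • z := by
      intro x z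
      module
    rw [key, e1, e2, one_smul]

theorem derivation_sum_expTerm (hD : ∀ v, D (L v) = P v + L (D v) + T v)
    (hT : ∀ v, T (L v) = Q v + L (T v)) (hLP : ∀ v, L (P v) = P (L v))
    (hLQ : ∀ v, L (Q v) = Q (L v)) (hTe : T e = 0) (hDe : D e = 0) {N : ℕ}
    (hN : ∀ n, N ≤ n → expTerm c L e n = 0) :
    D (∑ n ∈ Finset.range N, expTerm c L e n) =
      P (∑ n ∈ Finset.range N, expTerm c L e n) +
        c 1 • Q (∑ n ∈ Finset.range N, expTerm c L e n) := by
  have h0 : c 0 = 1 := by simpa using hc 0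
  have h1 : D (expTerm c L e 1) = P e := by
    rw [← zero_add 1, expTerm_succ, expTerm_zero, map_smul, hD, hTe, hDe, map_zero, add_zero,
      add_zero, h0, one_smul]
  have e1 : ∑ n ∈ Finset.range (N + 1), expTerm c L e n =
      ∑ n ∈ Finset.range N, expTerm c L e n := by
    rw [Finset.sum_range_succ, hN N le_rfl, add_zero]
  have e2 : ∑ n ∈ Finset.range (N + 2), expTerm c L e n =
      ∑ n ∈ Finset.range N, expTerm c L e n := by
    rw [Finset.sum_range_succ, e1, hN (N + 1) (Nat.le_succ N), add_zero]
  have lhs : D (∑ n ∈ Finset.range (N + 2), expTerm c L e n) =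
      P (∑ n ∈ Finset.range (N + 1), expTerm c L e n) +
        c 1 • Q (∑ n ∈ Finset.range N, expTerm c L e n) := by
    rw [Finset.sum_range_succ', Finset.sum_range_succ', Finset.sum_range_succ' _ N]
    simp only [map_add, map_sum, derivation_expTerm hc hD hT hLP hLQ hTe hDe,
      Finset.sum_add_distrib, Finset.smul_sum, zero_add, h1]
    simp only [expTerm_zero, hDe]
    abel
  rwa [e1, e2] at lhs

end expTerm

/-! ### Strictness of the differential -/

section Bigraded

variable {R : Type u} [CommRing R] {C : Type v} [AddCommGroup C] [Module R C]
  {K : ℤ → ℤ → Submodule R C} {D : C →ₗ[R] C}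

theorem filt_anti {p q : ℤ} (h : p ≤ q) (n : ℤ) : filt K q n ≤ filt K p n :=
  iSup₂_le fun a ha => le_iSup₂ (f := fun a (_ : p ≤ a) => K a (n - a)) a (h.trans ha)

theorem mem_filt_add_one_of_degeneratesFrom {hD : ∀ x, D (D x) = 0} {n : ℤ}
    (h : DegeneratesFrom K D hD n) {r p : ℤ} (hr : 1 ≤ r) {x : C} (hx : x ∈ filt K p n)
    (hDx : D x ∈ filt K (p + r) (n + 1)) :
    ∃ z ∈ filt K (p + 1) n, D (x - z) ∈ filt K (p + r + 1) (n + 1) ∧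
      D z ∈ filt K (p + r) (n + 1) := by
  have h0 : (Submodule.Quotient.mk ⟨D x, ssZ_le_comap K D hD r p n x ⟨hx, hDx⟩⟩ :
      ssE K D r (p + r) (n + 1)) = 0 :=
    LinearMap.congr_fun (h r hr p) (Submodule.Quotient.mk ⟨x, hx, hDx⟩)
  rw [Submodule.Quotient.mk_eq_zero] at h0
  obtain ⟨y, hy, _, ⟨z, hz, rfl⟩, hyz⟩ := Submodule.mem_sup.1 h0
  change y + D z = D x at hyz
  rw [show p + r - r + 1 = p + 1 by ring, show n + 1 - 1 = n by ring] at hz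
  refine ⟨z, hz.1, ?_, ?_⟩
  · rw [map_sub, ← hyz, add_sub_cancel_right]
    exact hy.1
  · have := hz.2
    rw [show p + 1 + (r - 1) = p + r by ring] at this
    exact this

/-- If the spectral sequence degenerates in total degree `n`, then the differential is strict with
respect to the filtration. -/
theorem exists_mem_filt_of_degeneratesFrom {hD : ∀ x, D (D x) = 0} {n : ℤ}
    (h : DegeneratesFrom K D hD n) {s : ℤ} (hs : filt K s (n + 1) = ⊥) {p q : ℤ} {x : C}
    (hx : x ∈ filt K p n) (hDx : D x ∈ filt K q (n + 1)) : ∃ z ∈ filt K q n, D z = D x := by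
  obtain ⟨j, hj⟩ : ∃ j : ℕ, s - q ≤ j := ⟨(s - q).toNat, Int.self_le_toNat _⟩
  induction j generalizing p q x with
  | zero =>
    have := filt_anti (K := K) (show s ≤ q by simpa using hj) (n + 1) hDx
    rw [hs, Submodule.mem_bot] at this
    exact ⟨0, zero_mem _, by rw [this, map_zero]⟩
  | succ j ihj =>
    obtain ⟨i, hi⟩ : ∃ i : ℕ, q - p ≤ i := ⟨(q - p).toNat, Int.self_le_toNat _⟩
    induction i generalizing p x with
    | zero => exact ⟨x, filt_anti (by simpa using hi) n hx, rfl⟩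
    | succ i ihi =>
      rcases le_or_gt q p with hqp | hqp
      · exact ⟨x, filt_anti hqp n hx, rfl⟩
      obtain ⟨z, hz, hxz, hDz⟩ := mem_filt_add_one_of_degeneratesFrom h (r := q - p)
        (by omega) hx (by rwa [add_sub_cancel])
      rw [add_sub_cancel] at hxz hDz
      obtain ⟨z₁, hz₁, e₁⟩ := ihi hz hDz (by push_cast at hi; omega)
      obtain ⟨z₂, hz₂, e₂⟩ :=
        ihj (sub_mem hx (filt_anti (by omega) n hz)) hxz (by push_cast at hj; omega)
      refine ⟨z₁ + z₂, add_mem hz₁ (filt_anti (by omega) n hz₂), ?_⟩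
      rw [map_add, e₁, e₂, map_sub, add_sub_cancel]

end Bigraded

/-! ### Base change -/

section BaseChange

variable {Λ : Type u} [CommRing Λ] {M : Type w} [AddCommGroup M] [Module Λ M]

theorem baseChange_induction {A : Type u} [CommRing A] [Algebra Λ A] {N : Submodule Λ M}
    {motive : A ⊗[Λ] M → Prop} (zero : motive 0)
    (tmul : ∀ (a : A), ∀ m ∈ N, motive (a ⊗ₜ m))
    (add : ∀ x z, motive x → motive z → motive (x + z)) {x : A ⊗[Λ] M}
    (hx : x ∈ N.baseChange A) : motive x := by
  obtain ⟨t, rfl⟩ := Submodule.toBaseChange_surjective' A N hx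
  induction t with
  | zero => simpa using zero
  | tmul a m => exact tmul a m m.2
  | add s t hs ht =>
    rw [map_add, Submodule.coe_add]
    exact add _ _ (hs (Subtype.prop _)) (ht (Subtype.prop _))

theorem rTensor_smul {A B : Type u} [CommRing A] [Algebra Λ A] [CommRing B] [Algebra Λ B]
    (f : A →ₐ[Λ] B) (a : A) (x : A ⊗[Λ] M) :
    f.toLinearMap.rTensor M (a • x) = f a • f.toLinearMap.rTensor M x := by
  induction x with
  | zero => simp
  | tmul b m => simp [TensorProduct.smul_tmul']
  | add s t hs ht => simp only [smul_add, map_add, hs, ht]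

theorem tmul_mem_smul_top {A : Type u} [CommRing A] [Algebra Λ A] {I : Ideal A} {a : A}
    (ha : a ∈ I) (m : M) : a ⊗ₜ[Λ] m ∈ I • (⊤ : Submodule A (A ⊗[Λ] M)) := by
  have : a ⊗ₜ[Λ] m = a • ((1 : A) ⊗ₜ[Λ] m) := by
    rw [TensorProduct.smul_tmul', smul_eq_mul, mul_one]
  rw [this]
  exact Submodule.smul_mem_smul ha trivial

theorem lTensor_mem_smul_top {A : Type u} [CommRing A] [Algebra Λ A] (T : M →ₗ[Λ] M)
    {I : Ideal A} {x : A ⊗[Λ] M} (hx : x ∈ I • (⊤ : Submodule A (A ⊗[Λ] M))) :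
    T.lTensor A x ∈ I • (⊤ : Submodule A (A ⊗[Λ] M)) := by
  rw [← LinearMap.baseChange_eq_ltensor]
  have := Submodule.mem_map_of_mem (f := T.baseChange A) hx
  rw [Submodule.map_smul''] at this
  exact Submodule.smul_mono le_rfl le_top this

theorem ker_rTensor_eq_smul_top {A B : Type u} [CommRing A] [Algebra Λ A] [CommRing B]
    [Algebra Λ B] (f : A →ₐ[Λ] B) (hf : Function.Surjective f) (x : A ⊗[Λ] M) :
    f.toLinearMap.rTensor M x = 0 ↔ x ∈ RingHom.ker f • (⊤ : Submodule A (A ⊗[Λ] M)) := by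
  constructor
  · intro hx
    have hex : Function.Exact (f.toLinearMap.ker.subtype) f.toLinearMap :=
      fun z => by simp
    obtain ⟨t, rfl⟩ := (rTensor_exact M hex hf x).1 hx
    induction t with
    | zero => simp
    | tmul a m => exact tmul_mem_smul_top (I := RingHom.ker f) a.2 m
    | add s t hs ht =>
      rw [map_add]
      refine add_mem (hs ?_) (ht ?_) <;>
      exact (rTensor_exact M hex hf _).2 ⟨_, rfl⟩
  · intro hx
    refine Submodule.smul_induction_on hx ?_ ?_
    · intro a ha m _
      rw [rTensor_smul, (RingHom.mem_ker (f := f)).1 ha, zero_smul]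
    · intro s t hs ht
      rw [map_add, hs, ht, add_zero]

variable {A : Type u} [CommRing A] [Algebra Λ A]

theorem lTensor_mem_baseChange {N N' : Submodule Λ M} {T : M →ₗ[Λ] M} (h : ∀ m ∈ N, T m ∈ N')
    {x : A ⊗[Λ] M} (hx : x ∈ N.baseChange A) : T.lTensor A x ∈ N'.baseChange A :=
  baseChange_induction (motive := fun x => T.lTensor A x ∈ N'.baseChange A) (by simp)
    (fun a m hm => Submodule.tmul_mem_baseChange_of_mem a (h m hm))
    (fun _ _ hx hz => by rw [map_add]; exact add_mem hx hz) hx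

theorem lTensor_eq_self {N : Submodule Λ M} {T : M →ₗ[Λ] M} (h : ∀ m ∈ N, T m = m)
    {x : A ⊗[Λ] M} (hx : x ∈ N.baseChange A) : T.lTensor A x = x :=
  baseChange_induction (motive := fun x => T.lTensor A x = x) (by simp)
    (fun a m hm => by rw [LinearMap.lTensor_tmul, h m hm])
    (fun _ _ hx hz => by rw [map_add, hx, hz]) hx

theorem lTensor_eq_zero {N : Submodule Λ M} {T : M →ₗ[Λ] M} (h : ∀ m ∈ N, T m = 0)
    {x : A ⊗[Λ] M} (hx : x ∈ N.baseChange A) : T.lTensor A x = 0 :=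
  baseChange_induction (motive := fun x => T.lTensor A x = 0) (by simp)
    (fun a m hm => by rw [LinearMap.lTensor_tmul, h m hm, TensorProduct.tmul_zero])
    (fun _ _ hx hz => by rw [map_add, hx, hz, add_zero]) hx

theorem bilin_mem_baseChange {N N' N'' : Submodule Λ M} {B : M →ₗ[Λ] M →ₗ[Λ] M}
    (h : ∀ m ∈ N, ∀ n ∈ N', B m n ∈ N'') {x z : A ⊗[Λ] M} (hx : x ∈ N.baseChange A)
    (hz : z ∈ N'.baseChange A) :
    LinearMap.BilinMap.baseChange A B x z ∈ N''.baseChange A := by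
  refine baseChange_induction
    (motive := fun x => LinearMap.BilinMap.baseChange A B x z ∈ N''.baseChange A) (by simp)
    (fun a m hm => ?_) (fun _ _ h h' => ?_) hx
  · refine baseChange_induction
      (motive := fun z => LinearMap.BilinMap.baseChange A B (a ⊗ₜ m) z ∈ N''.baseChange A)
      (by simp) (fun b n hn => ?_) (fun _ _ h h' => ?_) hz
    · rw [LinearMap.BilinMap.baseChange_tmul]
      exact Submodule.tmul_mem_baseChange_of_mem _ (h m hm n hn)
    · rw [map_add]; exact add_mem h h'
  · rw [map_add, LinearMap.add_apply]; exact add_mem h h'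

theorem bilin_mem_mul_smul_top (B : M →ₗ[Λ] M →ₗ[Λ] M) {I J : Ideal A} {x z : A ⊗[Λ] M}
    (hx : x ∈ I • (⊤ : Submodule A (A ⊗[Λ] M))) (hz : z ∈ J • (⊤ : Submodule A (A ⊗[Λ] M))) :
    LinearMap.BilinMap.baseChange A B x z ∈ (I * J) • (⊤ : Submodule A (A ⊗[Λ] M)) := by
  refine Submodule.smul_induction_on hx ?_ ?_
  · intro a ha v _
    refine Submodule.smul_induction_on hz ?_ ?_
    · intro c hc t _
      rw [map_smul, map_smul, LinearMap.smul_apply, smul_smul, mul_comm c a]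
      exact Submodule.smul_mem_smul (Ideal.mul_mem_mul ha hc) trivial
    · intro s t hs ht
      rw [map_add]
      exact add_mem hs ht
  · intro s t hs ht
    rw [map_add, LinearMap.add_apply]
    exact add_mem hs ht

end BaseChange

/-! ### Simple steps and the reduction to the residue field -/

theorem ArtAlg.isNilpotent_maximalIdeal {Λ : Type u} [CommRing Λ] (A : ArtAlg Λ) :
    IsNilpotent (IsLocalRing.maximalIdeal A) := by
  have := IsArtinianRing.isNilpotent_jacobson_bot (R := A)
  rwa [IsLocalRing.jacobson_eq_maximalIdeal ⊥ bot_ne_top] at this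

section ArtAlg

variable {Λ : Type u} [CommRing Λ] [IsLocalRing Λ]

theorem ArtAlg.A₀_smul_one_surjective (z : ArtAlg.A₀ Λ) : ∃ c : Λ, c • (1 : ArtAlg.A₀ Λ) = z := by
  obtain ⟨c, rfl⟩ := IsLocalRing.residue_surjective (R := Λ) z
  refine ⟨c, ?_⟩
  rw [Algebra.smul_def, mul_one]
  rfl

theorem ArtAlg.toA₀_surjective (A : ArtAlg Λ) : Function.Surjective A.toA₀.toAlgHom := by
  intro z
  obtain ⟨c, rfl⟩ := ArtAlg.A₀_smul_one_surjective z
  exact ⟨algebraMap Λ A c, by rw [AlgHom.commutes, Algebra.smul_def, mul_one]⟩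

theorem ArtAlg.ker_toA₀ (A : ArtAlg Λ) :
    RingHom.ker A.toA₀.toAlgHom = IsLocalRing.maximalIdeal A := by
  exact IsLocalRing.eq_maximalIdeal
    (RingHom.ker_isMaximal_of_surjective (K := IsLocalRing.ResidueField Λ)
      A.toA₀.toAlgHom.toRingHom A.toA₀_surjective)

theorem ArtAlg.algebraMap_mem_maximalIdeal (A : ArtAlg Λ) {c : Λ}
    (hc : c ∈ IsLocalRing.maximalIdeal Λ) : algebraMap Λ A c ∈ IsLocalRing.maximalIdeal A := by
  rw [← A.ker_toA₀, RingHom.mem_ker, AlgHom.commutes]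
  exact Ideal.Quotient.eq_zero_iff_mem.2 hc

theorem ArtAlg.exists_sub_algebraMap_mem (A : ArtAlg Λ) (a : A) :
    ∃ c : Λ, a - algebraMap Λ A c ∈ IsLocalRing.maximalIdeal A := by
  obtain ⟨c, hc⟩ := ArtAlg.A₀_smul_one_surjective (A.toA₀.toAlgHom a)
  refine ⟨c, ?_⟩
  rw [← A.ker_toA₀, RingHom.mem_ker, map_sub, AlgHom.commutes, ← hc, Algebra.smul_def, mul_one,
    sub_self]

variable {M : Type w} [AddCommGroup M] [Module Λ M]

theorem exists_mem_one_tmul_eq {N : Submodule Λ M} {x : ArtAlg.A₀ Λ ⊗[Λ] M}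
    (hx : x ∈ N.baseChange (ArtAlg.A₀ Λ)) : ∃ m ∈ N, 1 ⊗ₜ m = x := by
  refine baseChange_induction (motive := fun x => ∃ m ∈ N, 1 ⊗ₜ m = x)
    ⟨0, zero_mem _, TensorProduct.tmul_zero _ _⟩ ?_ ?_ hx
  · intro a m hm
    obtain ⟨c, rfl⟩ := ArtAlg.A₀_smul_one_surjective a
    exact ⟨c • m, N.smul_mem c hm, by rw [TensorProduct.smul_tmul]⟩
  · rintro _ _ ⟨m, hm, rfl⟩ ⟨n, hn, rfl⟩
    exact ⟨m + n, add_mem hm hn, TensorProduct.tmul_add _ _ _⟩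

theorem IsSimpleStep.exists_tmul_sub_mem {A : ArtAlg Λ} {K J : Ideal A} {b : A}
    (h : IsSimpleStep K J b) {x : A ⊗[Λ] M} (hx : x ∈ J • (⊤ : Submodule A (A ⊗[Λ] M))) :
    ∃ m : M, x - b ⊗ₜ m ∈ K • (⊤ : Submodule A (A ⊗[Λ] M)) := by
  have hadd : ∀ s t : A ⊗[Λ] M, (∃ m : M, s - b ⊗ₜ m ∈ K • (⊤ : Submodule A (A ⊗[Λ] M))) →
      (∃ m : M, t - b ⊗ₜ m ∈ K • (⊤ : Submodule A (A ⊗[Λ] M))) →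
      ∃ m : M, s + t - b ⊗ₜ m ∈ K • (⊤ : Submodule A (A ⊗[Λ] M)) := by
    rintro s t ⟨m, hm⟩ ⟨n, hn⟩
    refine ⟨m + n, ?_⟩
    rw [TensorProduct.tmul_add, add_sub_add_comm]
    exact add_mem hm hn
  refine Submodule.smul_induction_on hx ?_ hadd
  intro a ha v _
  induction v with
  | zero => exact ⟨0, by simp⟩
  | add s t hs ht => rw [smul_add]; exact hadd _ _ (hs trivial) (ht trivial)
  | tmul s m =>
    rw [h.eq_sup] at ha
    obtain ⟨k, hk, z, hz, rfl⟩ := Submodule.mem_sup.1 ha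
    obtain ⟨r, rfl⟩ := Ideal.mem_span_singleton'.1 hz
    obtain ⟨c, hc⟩ := A.exists_sub_algebraMap_mem (r * s)
    refine ⟨c • m, ?_⟩
    rw [← TensorProduct.smul_tmul, TensorProduct.smul_tmul', ← TensorProduct.sub_tmul]
    refine tmul_mem_smul_top ?_ m
    have e : (k + r * b) • s - c • b = s * k + (r * s - algebraMap Λ A c) * b := by
      rw [Algebra.smul_def c, smul_eq_mul]
      ring
    rw [e]
    exact add_mem (K.mul_mem_left _ hk) (h.mul_mem _ hc)

theorem IsSimpleStep.tmul_mem_iff [Module.Flat Λ M] {A : ArtAlg Λ} {K J : Ideal A} {b : A}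
    (h : IsSimpleStep K J b) (m : M) :
    b ⊗ₜ m ∈ K • (⊤ : Submodule A (A ⊗[Λ] M)) ↔ (1 : ArtAlg.A₀ Λ) ⊗ₜ[Λ] m = 0 := by
  let π : A →ₐ[Λ] A ⧸ K := Ideal.Quotient.mkₐ Λ K
  let g : Λ →ₗ[Λ] A ⧸ K := LinearMap.toSpanSingleton Λ (A ⧸ K) (π b)
  have hg : ∀ c, g c = π (algebraMap Λ A c * b) := fun c => by
    rw [map_mul, AlgHom.commutes, ← Algebra.smul_def]
    rfl
  have hle : IsLocalRing.maximalIdeal Λ ≤ LinearMap.ker g := by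
    intro c hc
    rw [LinearMap.mem_ker, hg]
    exact Ideal.Quotient.eq_zero_iff_mem.2 (h.mul_mem _ (A.algebraMap_mem_maximalIdeal hc))
  have hge : LinearMap.ker g ≤ IsLocalRing.maximalIdeal Λ := by
    refine IsLocalRing.le_maximalIdeal fun e => h.notMem ?_
    have : (1 : Λ) ∈ LinearMap.ker g := e ▸ Submodule.mem_top
    rw [LinearMap.mem_ker, hg, map_one, one_mul] at this
    exact Ideal.Quotient.eq_zero_iff_mem.1 this
  let ι : (Λ ⧸ IsLocalRing.maximalIdeal Λ) →ₗ[Λ] A ⧸ K :=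
    Submodule.liftQ (IsLocalRing.maximalIdeal Λ) g hle
  have hι : Function.Injective ι :=
    LinearMap.ker_eq_bot.1 (Submodule.ker_liftQ_eq_bot _ g hle hge)
  have hι1 : ι 1 = π b := by
    change g 1 = π b
    rw [hg, map_one, one_mul]
  have key : ι.rTensor M (1 ⊗ₜ m) = π.toLinearMap.rTensor M (b ⊗ₜ m) := by
    rw [LinearMap.rTensor_tmul, LinearMap.rTensor_tmul, hι1]
    rfl
  have hker : RingHom.ker π = K := Ideal.Quotient.mkₐ_ker Λ K
  rw [← hker, ← ker_rTensor_eq_smul_top π (Ideal.Quotient.mkₐ_surjective Λ K), ← key,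
    map_eq_zero_iff _ (Module.Flat.rTensor_preserves_injective_linearMap ι hι)]
  rfl

end ArtAlg

namespace CurvedBVAlgebra

variable {Λ : Type u} [CommRing Λ] [IsLocalRing Λ] {d : ℕ} {M : Type w} [AddCommGroup M]
  [Module Λ M] (G : CurvedBVAlgebra Λ d M)

/-! ### Homogeneous components -/

theorem homogeneous_induction {motive : M → Prop} (zero : motive 0)
    (homogeneous : ∀ p q : ℤ, ∀ a ∈ G.G p q, motive a)
    (add : ∀ a b, motive a → motive b → motive (a + b)) (m : M) : motive m := by
  have hm : m ∈ ⨆ pq : ℤ × ℤ, G.G pq.1 pq.2 := by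
    rw [G.isInternal.submodule_iSup_eq_top]
    trivial
  exact Submodule.iSup_induction (motive := motive) _ hm (fun pq => homogeneous pq.1 pq.2) zero add

theorem flat_total (G : CurvedBVAlgebra Λ d M) : Module.Flat Λ M := by
  have : ∀ pq : ℤ × ℤ, Module.Flat Λ (G.G pq.1 pq.2) := fun pq => G.flat pq.1 pq.2
  exact Module.Flat.of_linearEquiv (LinearEquiv.ofBijective
    (DirectSum.coeLinearMap fun pq : ℤ × ℤ => G.G pq.1 pq.2) G.isInternal).symm

open Classical in
/-- The projection of `M` to the sum of the components whose bidegree lies in `S`. -/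
noncomputable def projOn (S : Set (ℤ × ℤ)) : M →ₗ[Λ] M :=
  (DirectSum.toModule Λ (ℤ × ℤ) M
    fun pq => if pq ∈ S then (G.G pq.1 pq.2).subtype else 0) ∘ₗ
    (LinearEquiv.ofBijective
      (DirectSum.coeLinearMap fun pq : ℤ × ℤ => G.G pq.1 pq.2) G.isInternal).symm.toLinearMap

open Classical in
theorem projOn_of_mem_G (S : Set (ℤ × ℤ)) {p q : ℤ} {a : M} (ha : a ∈ G.G p q) :
    G.projOn S a = if (p, q) ∈ S then a else 0 := by
  have : (LinearEquiv.ofBijective (DirectSum.coeLinearMap fun pq : ℤ × ℤ => G.G pq.1 pq.2)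
      G.isInternal).symm a =
      DirectSum.lof Λ (ℤ × ℤ) (fun pq => G.G pq.1 pq.2) (p, q) ⟨a, ha⟩ := by
    rw [LinearEquiv.symm_apply_eq]
    exact (DirectSum.coeLinearMap_lof (fun pq : ℤ × ℤ => G.G pq.1 pq.2) (p, q) ⟨a, ha⟩).symm
  rw [projOn, LinearMap.comp_apply, LinearEquiv.coe_coe, this, DirectSum.toModule_lof]
  split_ifs <;> rfl

theorem projOn_eq_self {S : Set (ℤ × ℤ)} {p q : ℤ} (h : (p, q) ∈ S) {a : M}
    (ha : a ∈ G.G p q) : G.projOn S a = a := by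
  rw [G.projOn_of_mem_G S ha, if_pos h]

theorem projOn_eq_zero {S : Set (ℤ × ℤ)} {p q : ℤ} (h : (p, q) ∉ S) {a : M}
    (ha : a ∈ G.G p q) : G.projOn S a = 0 := by
  rw [G.projOn_of_mem_G S ha, if_neg h]

theorem projOn_mem {S : Set (ℤ × ℤ)} {N : Submodule Λ M} (h : ∀ pq ∈ S, G.G pq.1 pq.2 ≤ N)
    (m : M) : G.projOn S m ∈ N := by
  classical
  induction m using G.homogeneous_induction with
  | zero => simp
  | homogeneous p q a ha =>
    rw [G.projOn_of_mem_G S ha]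
    split_ifs with hS
    · exact h _ hS ha
    · exact zero_mem _
  | add a b ha hb => rw [map_add]; exact add_mem ha hb

theorem G_le_tot {p q n : ℤ} (h : p + q = n) : G.G p q ≤ tot G.G n := by
  obtain rfl : q = n - p := by omega
  exact le_iSup (fun a => G.G a (n - a)) p

theorem G_le_filt {p q s n : ℤ} (h : p + q = n) (hs : s ≤ p) : G.G p q ≤ filt G.G s n := by
  obtain rfl : q = n - p := by omega
  exact le_iSup₂ (f := fun a (_ : s ≤ a) => G.G a (n - a)) p hs

theorem tot_induction {n : ℤ} {motive : ∀ m : M, m ∈ tot G.G n → Prop}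
    (zero : motive 0 (zero_mem _))
    (homogeneous : ∀ (p q : ℤ) (h : p + q = n), ∀ a, ∀ ha : a ∈ G.G p q,
      motive a (G.G_le_tot h ha))
    (add : ∀ a b ha hb, motive a ha → motive b hb → motive (a + b) (add_mem ha hb))
    {m : M} (hm : m ∈ tot G.G n) : motive m hm :=
  Submodule.iSup_induction' (motive := motive) _
    (fun p => homogeneous p _ (add_sub_cancel _ _)) zero (fun a b ha hb => add a b ha hb) hm

theorem filt_induction {s n : ℤ} {motive : M → Prop} (zero : motive 0)
    (homogeneous : ∀ p q : ℤ, s ≤ p → p + q = n → ∀ a ∈ G.G p q, motive a)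
    (add : ∀ a b, motive a → motive b → motive (a + b)) {m : M} (hm : m ∈ filt G.G s n) :
    motive m := by
  rw [filt, iSup_subtype'] at hm
  exact Submodule.iSup_induction (motive := motive) _ hm
    (fun p => homogeneous p _ p.2 (add_sub_cancel _ _)) zero add

/-- The projection of `M` to the part of total degree `n`. -/
noncomputable def projTot (n : ℤ) : M →ₗ[Λ] M := G.projOn {pq | pq.1 + pq.2 = n}

theorem projTot_mem (n : ℤ) (m : M) : G.projTot n m ∈ tot G.G n :=
  G.projOn_mem (fun _ h => G.G_le_tot h) m

theorem projTot_eq_self {n : ℤ} {m : M} (hm : m ∈ tot G.G n) : G.projTot n m = m := by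
  induction hm using G.tot_induction with
  | zero => simp
  | homogeneous p q h a ha => exact G.projOn_eq_self h ha
  | add a b _ _ ha hb => rw [map_add, ha, hb]

theorem exists_eq_add_of_mem_filt {m : M} (hm : m ∈ filt G.G (-1) 0) :
    ∃ φ ∈ G.G (-1) 1, ∃ f ∈ G.G 0 0, m = φ + f := by
  refine G.filt_induction (motive := fun m => ∃ φ ∈ G.G (-1) 1, ∃ f ∈ G.G 0 0, m = φ + f)
    ⟨0, zero_mem _, 0, zero_mem _, (add_zero 0).symm⟩ ?_ ?_ hm
  · intro p q hp hpq a ha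
    rcases lt_or_ge 0 p with h | h
    · rw [G.eq_bot p q (by omega), Submodule.mem_bot] at ha
      exact ⟨0, zero_mem _, 0, zero_mem _, by rw [ha, add_zero]⟩
    · obtain rfl | rfl : p = -1 ∨ p = 0 := by omega
      · obtain rfl : q = 1 := by omega
        exact ⟨a, ha, 0, zero_mem _, (add_zero a).symm⟩
      · obtain rfl : q = 0 := by omega
        exact ⟨0, zero_mem _, a, ha, (zero_add a).symm⟩
  · rintro _ _ ⟨φ, hφ, f, hf, rfl⟩ ⟨ψ, hψ, g, hg, rfl⟩
    exact ⟨φ + ψ, add_mem hφ hψ, f + g, add_mem hf hg, add_add_add_comm _ _ _ _⟩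

/-! ### Identities for elements of total degree zero -/

theorem wedge_mem_tot {a b : M} (ha : a ∈ tot G.G 0) (hb : b ∈ tot G.G 0) :
    G.wedge a b ∈ tot G.G 0 := by
  induction ha using G.tot_induction with
  | zero => simp
  | add a a' _ _ ha ha' => rw [map_add, LinearMap.add_apply]; exact add_mem ha ha'
  | homogeneous p q h a ha =>
    induction hb using G.tot_induction with
    | zero => simp
    | add b b' _ _ hb hb' => rw [map_add]; exact add_mem hb hb'
    | homogeneous p' q' h' b hb =>
      exact G.G_le_tot (by omega) (G.wedge_mem p q p' q' a ha b hb)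

theorem wedge_comm_of_mem_tot {a : M} (ha : a ∈ tot G.G 0) (b : M) :
    G.wedge a b = G.wedge b a := by
  induction ha using G.tot_induction with
  | zero => simp
  | add a a' _ _ ha ha' => rw [map_add, map_add, LinearMap.add_apply, ha, ha']
  | homogeneous p q h a ha =>
    induction b using G.homogeneous_induction with
    | zero => simp
    | add b b' hb hb' => rw [map_add, map_add, LinearMap.add_apply, hb, hb']
    | homogeneous p' q' b hb =>
      rw [G.wedge_comm p q p' q' a ha b hb, h, zero_mul, Int.negOnePow_zero, one_smul]

theorem wedge_left_comm_of_mem_tot {a : M} (ha : a ∈ tot G.G 0) (b c : M) :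
    G.wedge a (G.wedge b c) = G.wedge b (G.wedge a c) := by
  rw [← G.wedge_assoc, G.wedge_comm_of_mem_tot ha, G.wedge_assoc]

theorem one_mem_tot : G.one ∈ tot G.G 0 := G.G_le_tot (add_zero 0) G.one_mem

theorem wedge_one (a : M) : G.wedge a G.one = a := by
  rw [← G.wedge_comm_of_mem_tot G.one_mem_tot, G.one_wedge]

theorem d_wedge_of_mem_tot {a : M} (ha : a ∈ tot G.G 0) (b : M) :
    (G.Δ + G.dbar) (G.wedge a b) =
      G.wedge ((G.Δ + G.dbar) a) b + G.wedge a ((G.Δ + G.dbar) b) + G.bracket a b := by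
  induction ha using G.tot_induction with
  | zero => simp
  | add a a' _ _ ha ha' =>
    rw [map_add G.wedge, LinearMap.add_apply (G.wedge a), map_add (G.Δ + G.dbar) (G.wedge a b), ha,
      ha', map_add (G.Δ + G.dbar) a]
    generalize G.Δ + G.dbar = D
    simp only [map_add, LinearMap.add_apply]
    abel
  | homogeneous p q h a ha =>
    simp only [LinearMap.add_apply, map_add, G.Δ_wedge p q a ha, G.dbar_wedge p q a ha, h,
      Int.negOnePow_zero, one_smul]
    abel

theorem bracket_wedge_of_mem_tot (a : M) {b : M} (hb : b ∈ tot G.G 0) (c : M) :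
    G.bracket a (G.wedge b c) = G.wedge (G.bracket a b) c + G.wedge b (G.bracket a c) := by
  induction a using G.homogeneous_induction with
  | zero => simp
  | add a a' ha ha' =>
    simp only [map_add, LinearMap.add_apply, ha, ha']
    abel
  | homogeneous p q a ha =>
    induction hb using G.tot_induction with
    | zero => simp
    | add b b' _ _ hb hb' =>
      simp only [map_add, LinearMap.add_apply, hb, hb']
      abel
    | homogeneous p' q' h b hb =>
      rw [G.poisson p q p' q' a ha b hb, h, mul_zero, Int.negOnePow_zero, one_smul]

theorem bracket_one (a : M) : G.bracket a G.one = 0 := by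
  have h := G.bracket_wedge_of_mem_tot a G.one_mem_tot G.one
  rw [G.one_wedge, G.wedge_one, G.one_wedge] at h
  exact left_eq_add.1 h

theorem d_one : (G.Δ + G.dbar) G.one = 0 := by
  have h := G.d_wedge_of_mem_tot G.one_mem_tot G.one
  rw [G.one_wedge, G.wedge_one, G.one_wedge, G.bracket_one, add_zero] at h
  exact left_eq_add.1 h

theorem bracket_comm_of_mem {φ f : M} (hφ : φ ∈ G.G (-1) 1) (hf : f ∈ G.G 0 0) :
    G.bracket f φ = G.bracket φ f := by
  rw [G.bracket_antisymm 0 0 (-1) 1 f hf φ hφ,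
    show ((0 + 0 + 1) * (-1 + 1 + 1) : ℤ).negOnePow = -1 by decide, Units.neg_smul, one_smul,
    neg_neg]

theorem bracket_eq_zero_of_mem {f g : M} (hf : f ∈ G.G 0 0) (hg : g ∈ G.G 0 0) :
    G.bracket f g = 0 := by
  have h := G.bracket_mem 0 0 0 0 f hf g hg
  rwa [G.eq_bot _ _ (by omega), Submodule.mem_bot] at h

theorem Δ_eq_zero_of_mem {f : M} {q : ℤ} (hf : f ∈ G.G 0 q) : G.Δ f = 0 := by
  have h := G.Δ_mem 0 q f hf
  rwa [G.eq_bot _ _ (by omega), Submodule.mem_bot] at h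

theorem d_mem_tot {n : ℤ} {a : M} (ha : a ∈ tot G.G n) : (G.Δ + G.dbar) a ∈ tot G.G (n + 1) := by
  induction ha using G.tot_induction with
  | zero => simp
  | add a b _ _ ha hb => rw [map_add]; exact add_mem ha hb
  | homogeneous p q h a ha =>
    exact add_mem (G.G_le_tot (by omega) (G.Δ_mem p q a ha))
      (G.G_le_tot (by omega) (G.dbar_mem p q a ha))

theorem wedge_ℓ_add_y_mem_tot {n : ℤ} {a : M} (ha : a ∈ tot G.G n) :
    G.wedge (G.ℓ + G.y) a ∈ tot G.G (n + 1) := by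
  induction ha using G.tot_induction with
  | zero => simp
  | add a b _ _ ha hb => rw [map_add]; exact add_mem ha hb
  | homogeneous p q h a ha =>
    rw [map_add, LinearMap.add_apply]
    exact add_mem (G.G_le_tot (by omega) (G.wedge_mem _ _ _ _ _ G.ℓ_mem' _ ha))
      (G.G_le_tot (by omega) (G.wedge_mem _ _ _ _ _ G.y_mem' _ ha))

theorem dcheck_mem_tot {n : ℤ} {a : M} (ha : a ∈ tot G.G n) : G.dcheck a ∈ tot G.G (n + 1) :=
  add_mem (G.d_mem_tot ha) (G.wedge_ℓ_add_y_mem_tot ha)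

/-! ### Identities after base change -/

section BaseChange

variable (A : Type u) [CommRing A] [Algebra Λ A]

theorem mem_tot_GΛ_iff {n : ℤ} {x : A ⊗[Λ] M} :
    x ∈ tot (G.GΛ A) n ↔ x ∈ (tot G.G n).baseChange A := by
  constructor
  · have : tot (G.GΛ A) n ≤ ((tot G.G n).baseChange A).restrictScalars Λ :=
      iSup_le fun p => Submodule.baseChange_mono A (G.G_le_tot (add_sub_cancel _ _))
    exact fun h => this h
  · refine baseChange_induction (zero_mem _) (fun a m hm => ?_) fun _ _ hx hz => add_mem hx hz
    induction hm using G.tot_induction with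
    | zero => rw [TensorProduct.tmul_zero]; exact zero_mem _
    | add m m' _ _ h h' => rw [TensorProduct.tmul_add]; exact add_mem h h'
    | homogeneous p q h m hm =>
      obtain rfl : q = n - p := by omega
      exact le_iSup (fun p => G.GΛ A p (n - p)) p (Submodule.tmul_mem_baseChange_of_mem a hm)

theorem mem_filt_GΛ_iff {s n : ℤ} {x : A ⊗[Λ] M} :
    x ∈ filt (G.GΛ A) s n ↔ x ∈ (filt G.G s n).baseChange A := by
  constructor
  · have : filt (G.GΛ A) s n ≤ ((filt G.G s n).baseChange A).restrictScalars Λ :=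
      iSup₂_le fun p hp => Submodule.baseChange_mono A (G.G_le_filt (add_sub_cancel _ _) hp)
    exact fun h => this h
  · refine baseChange_induction (zero_mem _) (fun a m hm => ?_) fun _ _ hx hz => add_mem hx hz
    refine G.filt_induction (motive := fun m => a ⊗ₜ m ∈ filt (G.GΛ A) s n) ?_ ?_ ?_ hm
    · rw [TensorProduct.tmul_zero]; exact zero_mem _
    · intro p q hp hpq m hm
      obtain rfl : q = n - p := by omega
      exact le_iSup₂ (f := fun p (_ : s ≤ p) => G.GΛ A p (n - p)) p hp
        (Submodule.tmul_mem_baseChange_of_mem a hm)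
    · intro m m' h h'
      rw [TensorProduct.tmul_add]; exact add_mem h h'

/-- The product of `A ⊗ M`. -/
noncomputable def wedgeA : A ⊗[Λ] M →ₗ[A] A ⊗[Λ] M →ₗ[A] A ⊗[Λ] M :=
  LinearMap.BilinMap.baseChange A G.wedge

/-- The operator `Δ + ∂̄` of `A ⊗ M`. -/
noncomputable def dA : A ⊗[Λ] M →ₗ[Λ] A ⊗[Λ] M := (G.Δ + G.dbar).lTensor A

theorem wedgeA_tmul (a b : A) (m n : M) :
    G.wedgeA A (a ⊗ₜ m) (b ⊗ₜ n) = (a * b) ⊗ₜ G.wedge m n := by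
  simp [wedgeA]

theorem bracketA_tmul (a b : A) (m n : M) :
    G.bracketA A (a ⊗ₜ m) (b ⊗ₜ n) = (a * b) ⊗ₜ G.bracket m n := by
  simp [bracketA]

theorem dA_tmul (a : A) (m : M) : G.dA A (a ⊗ₜ m) = a ⊗ₜ (G.Δ + G.dbar) m :=
  LinearMap.lTensor_tmul _ _ _ _

theorem dcheckA_eq (x : A ⊗[Λ] M) :
    G.dcheckA A x = G.dA A x + G.wedgeA A (1 ⊗ₜ (G.ℓ + G.y)) x := by
  induction x with
  | zero => simp
  | add s t hs ht => rw [map_add, map_add, map_add, hs, ht]; abel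
  | tmul a m =>
    rw [dA_tmul, wedgeA_tmul, one_mul, ← TensorProduct.tmul_add]
    exact LinearMap.lTensor_tmul _ _ _ _

theorem wedgeA_left_comm {x : A ⊗[Λ] M} (hx : x ∈ (tot G.G 0).baseChange A) (z t : A ⊗[Λ] M) :
    G.wedgeA A x (G.wedgeA A z t) = G.wedgeA A z (G.wedgeA A x t) := by
  refine baseChange_induction (motive := fun x =>
    G.wedgeA A x (G.wedgeA A z t) = G.wedgeA A z (G.wedgeA A x t)) (by simp)
    (fun a m hm => ?_) (fun _ _ h h' => ?_) hx
  · induction z with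
    | zero => simp
    | add s s' h h' => simp only [map_add, LinearMap.add_apply, h, h']
    | tmul b n =>
      induction t with
      | zero => simp
      | add s s' h h' => simp only [map_add, h, h']
      | tmul c l =>
        simp only [wedgeA_tmul, G.wedge_left_comm_of_mem_tot hm, mul_left_comm a]
  · simp only [map_add, LinearMap.add_apply, h, h']

theorem dA_wedgeA {x : A ⊗[Λ] M} (hx : x ∈ (tot G.G 0).baseChange A) (z : A ⊗[Λ] M) :
    G.dA A (G.wedgeA A x z) =
      G.wedgeA A (G.dA A x) z + G.wedgeA A x (G.dA A z) + G.bracketA A x z := by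
  refine baseChange_induction (motive := fun x => G.dA A (G.wedgeA A x z) =
      G.wedgeA A (G.dA A x) z + G.wedgeA A x (G.dA A z) + G.bracketA A x z) (by simp)
    (fun a m hm => ?_) (fun _ _ h h' => ?_) hx
  · induction z with
    | zero => simp
    | add s s' h h' => simp only [map_add, h, h']; abel
    | tmul b n =>
      simp only [wedgeA_tmul, dA_tmul, bracketA_tmul, G.d_wedge_of_mem_tot hm,
        TensorProduct.tmul_add]
  · simp only [map_add, LinearMap.add_apply, h, h']; abel

theorem bracketA_wedgeA (x : A ⊗[Λ] M) {z : A ⊗[Λ] M} (hz : z ∈ (tot G.G 0).baseChange A)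
    (t : A ⊗[Λ] M) :
    G.bracketA A x (G.wedgeA A z t) =
      G.wedgeA A (G.bracketA A x z) t + G.wedgeA A z (G.bracketA A x t) := by
  refine baseChange_induction (motive := fun z => G.bracketA A x (G.wedgeA A z t) =
      G.wedgeA A (G.bracketA A x z) t + G.wedgeA A z (G.bracketA A x t)) (by simp)
    (fun b n hn => ?_) (fun _ _ h h' => ?_) hz
  · induction x with
    | zero => simp
    | add s s' h h' => simp only [map_add, LinearMap.add_apply, h, h']; abel
    | tmul a m =>
      induction t with
      | zero => simp
      | add s s' h h' => simp only [map_add, h, h']; abel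
      | tmul c l =>
        simp only [wedgeA_tmul, bracketA_tmul, G.bracket_wedge_of_mem_tot m hn,
          TensorProduct.tmul_add, mul_assoc, mul_left_comm a]
  · simp only [map_add, LinearMap.add_apply, h, h']; abel

theorem wedgeA_one (x : A ⊗[Λ] M) : G.wedgeA A x (1 ⊗ₜ G.one) = x := by
  induction x with
  | zero => simp
  | add s s' h h' => simp only [map_add, LinearMap.add_apply, h, h']
  | tmul a m => rw [wedgeA_tmul, mul_one, G.wedge_one]

theorem bracketA_one (x : A ⊗[Λ] M) : G.bracketA A x (1 ⊗ₜ G.one) = 0 := by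
  induction x with
  | zero => simp
  | add s s' h h' => simp only [map_add, LinearMap.add_apply, h, h', add_zero]
  | tmul a m => rw [bracketA_tmul, G.bracket_one, TensorProduct.tmul_zero]

theorem dA_one : G.dA A (1 ⊗ₜ G.one) = 0 := by
  rw [dA_tmul, G.d_one, TensorProduct.tmul_zero]

theorem bracketA_comm {φ f : A ⊗[Λ] M} (hφ : φ ∈ G.GA A (-1) 1) (hf : f ∈ G.GA A 0 0) :
    G.bracketA A f φ = G.bracketA A φ f := by
  refine baseChange_induction (motive := fun f => G.bracketA A f φ = G.bracketA A φ f) (by simp)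
    (fun a m hm => ?_) (fun _ _ h h' => by rw [map_add, map_add, LinearMap.add_apply, h, h']) hf
  refine baseChange_induction
    (motive := fun φ => G.bracketA A (a ⊗ₜ m) φ = G.bracketA A φ (a ⊗ₜ m)) (by simp)
    (fun b n hn => ?_) (fun _ _ h h' => by rw [map_add, map_add, LinearMap.add_apply, h, h']) hφ
  rw [bracketA_tmul, bracketA_tmul, G.bracket_comm_of_mem hn hm, mul_comm]

/-! ### The exponential of a solution -/

theorem exists_exp (k : Type v) [Field k] [CharZero k] [Algebra k Λ] {I : Ideal A}
    (hI : IsNilpotent I) {x : A ⊗[Λ] M} (hx : x ∈ (tot G.G 0).baseChange A)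
    (hxI : x ∈ I • (⊤ : Submodule A (A ⊗[Λ] M))) :
    ∃ Ω ∈ (tot G.G 0).baseChange A, Ω - 1 ⊗ₜ G.one ∈ I • (⊤ : Submodule A (A ⊗[Λ] M)) ∧
      G.dcheckA A Ω = G.wedgeA A (G.dA A x + algebraMap k Λ (1 / 2) • G.bracketA A x x +
        1 ⊗ₜ (G.ℓ + G.y)) Ω := by
  obtain ⟨N, hN⟩ := hI
  let c : ℕ → Λ := fun n => algebraMap k Λ (1 / ((n : k) + 1))
  have hc : ∀ n : ℕ, ((n : Λ) + 1) * c n = 1 := by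
    intro n
    have h1 : ((n : Λ) + 1) = algebraMap k Λ ((n : k) + 1) := by simp
    rw [h1, ← map_mul, mul_one_div_cancel (Nat.cast_add_one_ne_zero n), map_one]
  let L : A ⊗[Λ] M →ₗ[Λ] A ⊗[Λ] M := (G.wedgeA A x).restrictScalars Λ
  let E := expTerm c L ((1 : A) ⊗ₜ[Λ] G.one)
  have hE_tot : ∀ n, E n ∈ (tot G.G 0).baseChange A := by
    intro n
    induction n with
    | zero => exact Submodule.tmul_mem_baseChange_of_mem _ G.one_mem_tot
    | succ n ih =>
      exact Submodule.smul_of_tower_mem _ (c n)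
        (bilin_mem_baseChange (fun a ha b hb => G.wedge_mem_tot ha hb) hx ih)
  have hE_pow : ∀ n, E n ∈ I ^ n • (⊤ : Submodule A (A ⊗[Λ] M)) := by
    intro n
    induction n with
    | zero => rw [pow_zero, Ideal.one_eq_top, Submodule.top_smul]; trivial
    | succ n ih =>
      rw [pow_succ']
      exact Submodule.smul_of_tower_mem _ (c n) (bilin_mem_mul_smul_top G.wedge hxI ih)
  have hE_zero : ∀ n, N + 1 ≤ n → E n = 0 := by
    intro n hn
    have h := hE_pow n
    have h0 : I ^ n = ⊥ := by
      have := Ideal.pow_le_pow_right (I := I) (show N ≤ n by omega)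
      rwa [hN, Submodule.zero_eq_bot, le_bot_iff] at this
    rwa [h0, Submodule.bot_smul, Submodule.mem_bot] at h
  have key := derivation_sum_expTerm hc (L := L) (D := G.dA A)
    (T := (G.bracketA A x).restrictScalars Λ) (P := (G.wedgeA A (G.dA A x)).restrictScalars Λ)
    (Q := (G.wedgeA A (G.bracketA A x x)).restrictScalars Λ) (e := 1 ⊗ₜ G.one)
    (G.dA_wedgeA A hx) (G.bracketA_wedgeA A x hx) (G.wedgeA_left_comm A hx _)
    (G.wedgeA_left_comm A hx _) (G.bracketA_one A x) (G.dA_one A) hE_zero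
  refine ⟨∑ n ∈ Finset.range (N + 1), E n, sum_mem fun n _ => hE_tot n, ?_, ?_⟩
  · rw [Finset.sum_range_succ']
    change _ + 1 ⊗ₜ G.one - 1 ⊗ₜ G.one ∈ _
    rw [add_sub_cancel_right]
    exact sum_mem fun n _ =>
      Submodule.smul_mono_left (Ideal.pow_le_self n.succ_ne_zero) (hE_pow (n + 1))
  · have hc1 : c 1 = algebraMap k Λ (1 / 2) := by
      simp only [c]
      norm_num
    have hs : ∀ (r : Λ) (z t : A ⊗[Λ] M), G.wedgeA A (r • z) t = r • G.wedgeA A z t := by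
      intro r z t
      rw [← algebraMap_smul A r z, ← algebraMap_smul A r (G.wedgeA A z t), map_smul,
        LinearMap.smul_apply]
    rw [dcheckA_eq, key, hc1, map_add, map_add, LinearMap.add_apply, LinearMap.add_apply, hs]
    rfl

end BaseChange

/-! ### Lifting of cocycles -/

theorem exists_cocycle_rTensor_eq (h2 : IsUnit (2 : Λ)) {A : ArtAlg Λ} {n : ℤ}
    (hsurj : Function.Surjective (G.mapHA A.toA₀.toAlgHom n)) {w : M} (hw : w ∈ tot G.G n)
    (hdw : (1 : ArtAlg.A₀ Λ) ⊗ₜ[Λ] G.dcheck w = 0) :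
    ∃ h ∈ (tot G.G n).baseChange A, G.dcheckA A h = 0 ∧
      A.toA₀.toAlgHom.toLinearMap.rTensor M h = 1 ⊗ₜ w := by
  have hw₀ : 1 ⊗ₜ w ∈ cocycles (G.GΛ (ArtAlg.A₀ Λ)) (G.dcheckA (ArtAlg.A₀ Λ)) n :=
    ⟨(G.mem_tot_GΛ_iff _).2 (Submodule.tmul_mem_baseChange_of_mem _ hw), hdw⟩
  obtain ⟨q, hq⟩ := hsurj (Submodule.Quotient.mk ⟨_, hw₀⟩)
  obtain ⟨⟨h, hh, hdh⟩, rfl⟩ := Submodule.Quotient.mk_surjective _ q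
  have hq' := (Submodule.Quotient.eq _).1 hq
  obtain ⟨z, hz, hdz⟩ : A.toA₀.toAlgHom.toLinearMap.rTensor M h - 1 ⊗ₜ w ∈
    coboundaries (G.GΛ (ArtAlg.A₀ Λ)) (G.dcheckA (ArtAlg.A₀ Λ)) n := hq'
  obtain ⟨m, hm, rfl⟩ := exists_mem_one_tmul_eq ((G.mem_tot_GΛ_iff _).1 hz)
  have hdm : ∀ a : A, G.dcheckA A (a ⊗ₜ m) = a ⊗ₜ G.dcheck m := fun a =>
    LinearMap.lTensor_tmul _ _ _ _
  refine ⟨h - 1 ⊗ₜ G.dcheck m, sub_mem ((G.mem_tot_GΛ_iff _).1 hh)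
    (Submodule.tmul_mem_baseChange_of_mem _ ?_), ?_, ?_⟩
  · have := G.dcheck_mem_tot hm
    rwa [sub_add_cancel] at this
  · rw [map_sub, LinearMap.mem_ker.1 hdh, dcheckA, LinearMap.lTensor_tmul,
      G.dcheck_dcheck h2, TensorProduct.tmul_zero, sub_zero]
  · have e : A.toA₀.toAlgHom.toLinearMap.rTensor M (1 ⊗ₜ G.dcheck m) =
        G.dcheckA (ArtAlg.A₀ Λ) (1 ⊗ₜ m) := by
      rw [LinearMap.rTensor_tmul, dcheckA, LinearMap.lTensor_tmul, AlgHom.toLinearMap_apply,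
        map_one]
    rw [map_sub, e, hdz, sub_sub_cancel]

theorem exists_mem_tot_tmul_sub_mem {A : ArtAlg Λ} {K J : Ideal A} {b : A}
    (hKJ : IsSimpleStep K J b) {n : ℤ} {x : A ⊗[Λ] M} (hx : x ∈ (tot G.G n).baseChange A)
    (hxJ : x ∈ J • (⊤ : Submodule A (A ⊗[Λ] M))) :
    ∃ w ∈ tot G.G n, x - b ⊗ₜ w ∈ K • (⊤ : Submodule A (A ⊗[Λ] M)) := by
  obtain ⟨m, hm⟩ := hKJ.exists_tmul_sub_mem hxJ
  refine ⟨G.projTot n m, G.projTot_mem n m, ?_⟩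
  have := lTensor_mem_smul_top (G.projTot n) hm
  rwa [map_sub, LinearMap.lTensor_tmul, lTensor_eq_self (fun _ => G.projTot_eq_self) hx] at this

/-- If `H^n(G_A) → H^n(G₀)` is surjective, then cocycles of degree `n` modulo an ideal of `A` lift
to cocycles over `A`. -/
theorem exists_cocycle_sub_mem (h2 : IsUnit (2 : Λ)) {A : ArtAlg Λ} {n : ℤ}
    (hsurj : Function.Surjective (G.mapHA A.toA₀.toAlgHom n)) {I : Ideal A} {x : A ⊗[Λ] M}
    (hx : x ∈ (tot G.G n).baseChange A)
    (hdx : G.dcheckA A x ∈ I • (⊤ : Submodule A (A ⊗[Λ] M))) :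
    ∃ h ∈ (tot G.G n).baseChange A, G.dcheckA A h = 0 ∧
      x - h ∈ I • (⊤ : Submodule A (A ⊗[Λ] M)) := by
  have := G.flat_total
  obtain ⟨J, ⟨hIJ, h, hh, hdh, hxh⟩, hmin⟩ := (wellFounded_lt (α := Ideal A)).has_min
    {J | I ≤ J ∧ ∃ h ∈ (tot G.G n).baseChange A, G.dcheckA A h = 0 ∧
      x - h ∈ J • (⊤ : Submodule A (A ⊗[Λ] M))}
    ⟨⊤, le_top, 0, zero_mem _, map_zero _, by rw [Submodule.top_smul]; trivial⟩
  rcases hIJ.eq_or_lt with rfl | hlt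
  · exact ⟨h, hh, hdh, hxh⟩
  exfalso
  obtain ⟨K, b, hIK, hKJ⟩ := exists_isSimpleStep hlt
  obtain ⟨w, hw, hxw⟩ := G.exists_mem_tot_tmul_sub_mem hKJ (sub_mem hx hh) hxh
  have hbw : b ⊗ₜ G.dcheck w ∈ K • (⊤ : Submodule A (A ⊗[Λ] M)) := by
    have h1 : G.dcheckA A (x - h - b ⊗ₜ w) ∈ K • (⊤ : Submodule A (A ⊗[Λ] M)) :=
      lTensor_mem_smul_top G.dcheck hxw
    rw [map_sub, map_sub, hdh, sub_zero] at h1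
    have h3 := sub_mem (Submodule.smul_mono_left hIK hdx) h1
    rwa [sub_sub_cancel, dcheckA, LinearMap.lTensor_tmul] at h3
  obtain ⟨g, hg, hdg, hgw⟩ :=
    G.exists_cocycle_rTensor_eq h2 hsurj hw ((hKJ.tmul_mem_iff _).1 hbw)
  refine hmin K ⟨hIK, h + b • g, add_mem hh (Submodule.smul_mem _ b hg), ?_, ?_⟩ hKJ.lt
  · have : G.dcheckA A (b • g) = b • G.dcheckA A g := by
      rw [dcheckA, ← LinearMap.baseChange_eq_ltensor, map_smul]
    rw [map_add, hdh, this, hdg, smul_zero, add_zero]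
  · have hgm : g - 1 ⊗ₜ w ∈
        IsLocalRing.maximalIdeal A • (⊤ : Submodule A (A ⊗[Λ] M)) := by
      rw [← A.ker_toA₀, ← ker_rTensor_eq_smul_top _ A.toA₀_surjective, map_sub, hgw,
        LinearMap.rTensor_tmul, AlgHom.toLinearMap_apply, map_one, sub_self]
    have hbg : b • (g - 1 ⊗ₜ w) ∈ K • (⊤ : Submodule A (A ⊗[Λ] M)) := by
      have h3 := Submodule.smul_mem_smul hKJ.mem hgm
      rw [← Submodule.mul_smul, mul_comm] at h3
      exact Submodule.smul_mono_left hKJ.maximalIdeal_mul_le h3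
    have e : x - (h + b • g) = (x - h - b ⊗ₜ w) - b • (g - 1 ⊗ₜ w) := by
      rw [smul_sub, TensorProduct.smul_tmul', smul_eq_mul, mul_one]
      abel
    rw [e]
    exact sub_mem hxw hbg

/-! ### The Maurer–Cartan equations -/

section MaurerCartan

variable (k : Type v) [Field k] [Algebra k Λ] (A : Type u) [CommRing A] [Algebra Λ A]

/-- The left hand side of the classical Maurer–Cartan equation. -/
noncomputable def classicalMC (φ : A ⊗[Λ] M) : A ⊗[Λ] M :=
  G.dbar.lTensor A φ + algebraMap k Λ (1 / 2) • G.bracketA A φ φ + 1 ⊗ₜ G.ℓ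

/-- The left hand side of the second equation of the semi-classical Maurer–Cartan functor. -/
noncomputable def volumeMC (φ f : A ⊗[Λ] M) : A ⊗[Λ] M :=
  G.dbar.lTensor A f + G.bracketA A φ f + 1 ⊗ₜ G.y + G.Δ.lTensor A φ

variable {A} {φ f : A ⊗[Λ] M}

theorem classicalMC_mem (hφ : φ ∈ G.GA A (-1) 1) : G.classicalMC k A φ ∈ G.GA A (-1) 2 := by
  have h1 : G.dbar.lTensor A φ ∈ G.GA A (-1) 2 :=
    lTensor_mem_baseChange (fun m hm => by simpa using G.dbar_mem (-1) 1 m hm) hφ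
  have h2 : G.bracketA A φ φ ∈ G.GA A (-1) 2 :=
    bilin_mem_baseChange (fun a ha b hb => by
      simpa using G.bracket_mem (-1) 1 (-1) 1 a ha b hb) hφ hφ
  have h3 : 1 ⊗ₜ G.ℓ ∈ G.GA A (-1) 2 := Submodule.tmul_mem_baseChange_of_mem _ G.ℓ_mem'
  exact add_mem (add_mem h1 (Submodule.smul_of_tower_mem _ _ h2)) h3

theorem volumeMC_mem (hφ : φ ∈ G.GA A (-1) 1) (hf : f ∈ G.GA A 0 0) :
    G.volumeMC A φ f ∈ G.GA A 0 1 := by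
  have h1 : G.dbar.lTensor A f ∈ G.GA A 0 1 :=
    lTensor_mem_baseChange (fun m hm => by simpa using G.dbar_mem 0 0 m hm) hf
  have h2 : G.bracketA A φ f ∈ G.GA A 0 1 :=
    bilin_mem_baseChange (fun a ha b hb => by
      simpa using G.bracket_mem (-1) 1 0 0 a ha b hb) hφ hf
  have h3 : 1 ⊗ₜ G.y ∈ G.GA A 0 1 := Submodule.tmul_mem_baseChange_of_mem _ G.y_mem'
  have h4 : G.Δ.lTensor A φ ∈ G.GA A 0 1 :=
    lTensor_mem_baseChange (fun m hm => by simpa using G.Δ_mem (-1) 1 m hm) hφ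
  exact add_mem (add_mem (add_mem h1 h2) h3) h4

theorem dA_add_bracketA_eq [CharZero k] (hφ : φ ∈ G.GA A (-1) 1) (hf : f ∈ G.GA A 0 0) :
    G.dA A (φ + f) + algebraMap k Λ (1 / 2) • G.bracketA A (φ + f) (φ + f) + 1 ⊗ₜ (G.ℓ + G.y) =
      G.classicalMC k A φ + G.volumeMC A φ f := by
  have h0 : G.Δ.lTensor A f = 0 := lTensor_eq_zero (fun _ => G.Δ_eq_zero_of_mem) hf
  have h1 : G.bracketA A f f = 0 := by
    have := bilin_mem_baseChange (N'' := ⊥) (B := G.bracket)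
      (fun a ha b hb => (Submodule.mem_bot _).2 (G.bracket_eq_zero_of_mem ha hb)) hf hf
    rwa [Submodule.baseChange_bot, Submodule.mem_bot] at this
  have h2 : algebraMap k Λ (1 / 2) + algebraMap k Λ (1 / 2) = 1 := by
    rw [← map_add, add_halves, map_one]
  have h3 : ∀ z : A ⊗[Λ] M, algebraMap k Λ (1 / 2) • (z + z) = z := fun z => by
    rw [smul_add, ← add_smul, h2, one_smul]
  have e : G.bracketA A (φ + f) (φ + f) =
      G.bracketA A φ φ + (G.bracketA A φ f + G.bracketA A φ f) := by
    rw [map_add, map_add, LinearMap.add_apply, LinearMap.add_apply, h1,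
      G.bracketA_comm A hφ hf, add_zero, add_assoc]
  rw [e, smul_add, h3, dA, LinearMap.lTensor_add, LinearMap.add_apply, map_add, map_add, h0,
    TensorProduct.tmul_add, classicalMC, volumeMC]
  abel

end MaurerCartan

theorem exists_filt_d_eq (hG : DegeneratesFrom (G.GΛ (ArtAlg.A₀ Λ)) G.d₀ G.d₀_d₀ 0) {w : M}
    (hw : w ∈ tot G.G 0)
    (hdw : 1 ⊗ₜ (G.Δ + G.dbar) w ∈ (filt G.G (-1) 1).baseChange (ArtAlg.A₀ Λ)) :
    ∃ φ ∈ G.G (-1) 1, ∃ f ∈ G.G 0 0,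
      (1 : ArtAlg.A₀ Λ) ⊗ₜ[Λ] (G.Δ + G.dbar) (w - (φ + f)) = 0 := by
  have htot : tot G.G 0 ≤ filt G.G (-(d : ℤ)) 0 := by
    intro m hm
    induction hm using G.tot_induction with
    | zero => exact zero_mem _
    | add a b _ _ ha hb => exact add_mem ha hb
    | homogeneous p q h a ha =>
      rcases lt_or_ge p (-(d : ℤ)) with hp | hp
      · rw [G.eq_bot p q (Or.inl hp), Submodule.mem_bot] at ha
        rw [ha]
        exact zero_mem _
      · exact G.G_le_filt h hp ha
  have hs : filt (G.GΛ (ArtAlg.A₀ Λ)) 1 (0 + 1) = ⊥ := by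
    refine (iSup₂_le fun p hp => ?_ : _ ≤ _).antisymm bot_le
    rw [GΛ, GA, G.eq_bot _ _ (by omega), Submodule.baseChange_bot]
    exact le_rfl
  obtain ⟨z, hz, hdz⟩ := exists_mem_filt_of_degeneratesFrom hG hs (p := -(d : ℤ)) (q := -1)
    (x := 1 ⊗ₜ w)
    ((G.mem_filt_GΛ_iff _).2 (Submodule.tmul_mem_baseChange_of_mem _ (htot hw)))
    ((G.mem_filt_GΛ_iff _).2 hdw)
  obtain ⟨m, hm, rfl⟩ := exists_mem_one_tmul_eq ((G.mem_filt_GΛ_iff _).1 hz)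
  obtain ⟨φ, hφ, f, hf, rfl⟩ := G.exists_eq_add_of_mem_filt hm
  refine ⟨φ, hφ, f, hf, ?_⟩
  have e : ∀ a : M, G.d₀ (1 ⊗ₜ a) = 1 ⊗ₜ (G.Δ + G.dbar) a := fun a =>
    LinearMap.lTensor_tmul _ _ _ _
  rw [map_sub, TensorProduct.tmul_sub, ← e, ← e, hdz, sub_self]

theorem dcheckA_tmul_sub_mem {A : ArtAlg Λ} {K J : Ideal A} {b : A} (hKJ : IsSimpleStep K J b)
    (w : M) : G.dcheckA A (b ⊗ₜ w) - b ⊗ₜ (G.Δ + G.dbar) w ∈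
      K • (⊤ : Submodule A (A ⊗[Λ] M)) := by
  have key : ∀ p q : ℤ, ∀ z ∈ IsLocalRing.maximalIdeal Λ • G.G p q,
      b ⊗ₜ G.wedge z w ∈ K • (⊤ : Submodule A (A ⊗[Λ] M)) := by
    intro p q z hz
    refine Submodule.smul_induction_on hz ?_ ?_
    · intro r hr t _
      rw [map_smul, LinearMap.smul_apply, ← TensorProduct.smul_tmul, Algebra.smul_def]
      exact tmul_mem_smul_top (hKJ.mul_mem _ (A.algebraMap_mem_maximalIdeal hr)) _
    · intro s t hs ht
      rw [map_add, LinearMap.add_apply, TensorProduct.tmul_add]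
      exact add_mem hs ht
  rw [dcheckA, LinearMap.lTensor_tmul, ← TensorProduct.tmul_sub]
  have e : G.dcheck w - (G.Δ + G.dbar) w = G.wedge G.ℓ w + G.wedge G.y w := by
    rw [dcheck, LinearMap.add_apply, map_add G.wedge, add_sub_cancel_left,
      LinearMap.add_apply]
  rw [e, TensorProduct.tmul_add]
  exact add_mem (key _ _ _ G.ℓ_mem) (key _ _ _ G.y_mem)

/-- The sum of the errors of an approximate solution is, up to `K`, a coboundary from filtration
degree `-1`. -/
theorem exists_classicalMC_add_volumeMC_sub_mem (k : Type v) [Field k] [CharZero k] [Algebra k Λ]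
    (hG : G.IsSemiPerfect) {A : ArtAlg Λ} {K J : Ideal A} {b : A} (hKJ : IsSimpleStep K J b)
    {φ f : A ⊗[Λ] M} (hφ : φ ∈ IsLocalRing.maximalIdeal A • G.GA A (-1) 1)
    (hf : f ∈ IsLocalRing.maximalIdeal A • G.GA A 0 0)
    (h : G.classicalMC k A φ + G.volumeMC A φ f ∈ J • (⊤ : Submodule A (A ⊗[Λ] M))) :
    ∃ φ₀ ∈ G.G (-1) 1, ∃ f₀ ∈ G.G 0 0,
      G.classicalMC k A φ + G.volumeMC A φ f - b ⊗ₜ (G.Δ + G.dbar) (φ₀ + f₀) ∈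
        K • (⊤ : Submodule A (A ⊗[Λ] M)) := by
  have := G.flat_total
  have h2 : IsUnit (2 : Λ) := by
    rw [← map_ofNat (algebraMap k Λ) 2]
    exact (isUnit_iff_ne_zero.2 two_ne_zero).map _
  have hφ' : φ ∈ G.GA A (-1) 1 := Submodule.smul_le_right hφ
  have hf' : f ∈ G.GA A 0 0 := Submodule.smul_le_right hf
  obtain ⟨Ω, hΩ, hΩ1, hdΩ⟩ := G.exists_exp A k A.isNilpotent_maximalIdeal (x := φ + f)
    (add_mem (Submodule.baseChange_mono A (G.G_le_tot (by norm_num)) hφ')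
      (Submodule.baseChange_mono A (G.G_le_tot (by norm_num)) hf'))
    (add_mem (Submodule.smul_mono le_rfl le_top hφ) (Submodule.smul_mono le_rfl le_top hf))
  rw [G.dA_add_bracketA_eq k hφ' hf'] at hdΩ
  set ε := G.classicalMC k A φ + G.volumeMC A φ f with hε
  have hεΩ : G.dcheckA A Ω - ε ∈ K • (⊤ : Submodule A (A ⊗[Λ] M)) := by
    have h3 : G.wedgeA A ε (Ω - 1 ⊗ₜ G.one) ∈ _ := bilin_mem_mul_smul_top G.wedge h hΩ1
    rw [map_sub, wedgeA_one, ← hdΩ, mul_comm] at h3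
    exact Submodule.smul_mono_left hKJ.maximalIdeal_mul_le h3
  have hΩJ : G.dcheckA A Ω ∈ J • (⊤ : Submodule A (A ⊗[Λ] M)) := by
    have := add_mem (Submodule.smul_mono_left hKJ.le hεΩ) h
    rwa [sub_add_cancel] at this
  obtain ⟨c, hc, hdc, hΩc⟩ := G.exists_cocycle_sub_mem h2 (hG.surjective A) hΩ hΩJ
  obtain ⟨w, hw, hΩw⟩ := G.exists_mem_tot_tmul_sub_mem hKJ (sub_mem hΩ hc) hΩc
  have hεw : ε - b ⊗ₜ (G.Δ + G.dbar) w ∈ K • (⊤ : Submodule A (A ⊗[Λ] M)) := by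
    have h3 : G.dcheckA A (Ω - c - b ⊗ₜ w) ∈ K • (⊤ : Submodule A (A ⊗[Λ] M)) :=
      lTensor_mem_smul_top G.dcheck hΩw
    rw [map_sub, map_sub, hdc, sub_zero] at h3
    have h4 := add_mem (sub_mem h3 hεΩ) (G.dcheckA_tmul_sub_mem hKJ w)
    have e : G.dcheckA A Ω - G.dcheckA A (b ⊗ₜ w) - (G.dcheckA A Ω - ε) +
        (G.dcheckA A (b ⊗ₜ w) - b ⊗ₜ (G.Δ + G.dbar) w) = ε - b ⊗ₜ (G.Δ + G.dbar) w := by abel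
    rwa [e] at h4
  let π := G.projOn {(-1, 2), (0, 1)}
  have hπε : π.lTensor A ε = ε := by
    rw [hε, map_add,
      lTensor_eq_self (fun _ => G.projOn_eq_self (by simp)) (G.classicalMC_mem k hφ'),
      lTensor_eq_self (fun _ => G.projOn_eq_self (by simp)) (G.volumeMC_mem hφ' hf')]
  have hπw : b ⊗ₜ (π ((G.Δ + G.dbar) w) - (G.Δ + G.dbar) w) ∈
      K • (⊤ : Submodule A (A ⊗[Λ] M)) := by
    have h3 := lTensor_mem_smul_top π hεw
    rw [map_sub, hπε, LinearMap.lTensor_tmul] at h3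
    have h4 := sub_mem hεw h3
    rwa [sub_sub_sub_cancel_left, ← TensorProduct.tmul_sub] at h4
  rw [hKJ.tmul_mem_iff, TensorProduct.tmul_sub, sub_eq_zero] at hπw
  have hπ_mem : π ((G.Δ + G.dbar) w) ∈ filt G.G (-1) 1 := by
    refine G.projOn_mem ?_ _
    rintro pq (rfl | rfl)
    · exact G.G_le_filt (by norm_num) le_rfl
    · exact G.G_le_filt (by norm_num) (by norm_num)
  obtain ⟨φ₀, hφ₀, f₀, hf₀, h₀⟩ := G.exists_filt_d_eq hG.degenerates hw
    (hπw ▸ Submodule.tmul_mem_baseChange_of_mem _ hπ_mem)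
  refine ⟨φ₀, hφ₀, f₀, hf₀, ?_⟩
  have h5 := add_mem hεw ((hKJ.tmul_mem_iff _).2 h₀)
  rwa [map_sub, TensorProduct.tmul_sub, sub_add_sub_cancel] at h5

theorem exists_correction (k : Type v) [Field k] [CharZero k] [Algebra k Λ]
    (hG : G.IsSemiPerfect) {A : ArtAlg Λ} {K J : Ideal A} {b : A} (hKJ : IsSimpleStep K J b)
    (hJ : J ≤ IsLocalRing.maximalIdeal A)
    {φ f : A ⊗[Λ] M} (hφ : φ ∈ IsLocalRing.maximalIdeal A • G.GA A (-1) 1)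
    (hf : f ∈ IsLocalRing.maximalIdeal A • G.GA A 0 0)
    (h1 : G.classicalMC k A φ ∈ J • (⊤ : Submodule A (A ⊗[Λ] M)))
    (h2 : G.volumeMC A φ f ∈ J • (⊤ : Submodule A (A ⊗[Λ] M))) :
    ∃ φ₀ ∈ G.G (-1) 1, ∃ f₀ ∈ G.G 0 0,
      G.classicalMC k A (φ - b ⊗ₜ φ₀) ∈ K • (⊤ : Submodule A (A ⊗[Λ] M)) ∧
      G.volumeMC A (φ - b ⊗ₜ φ₀) (f - b ⊗ₜ f₀) ∈ K • (⊤ : Submodule A (A ⊗[Λ] M)) := by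
  obtain ⟨φ₀, hφ₀, f₀, hf₀, h⟩ :=
    G.exists_classicalMC_add_volumeMC_sub_mem k hG hKJ hφ hf (add_mem h1 h2)
  refine ⟨φ₀, hφ₀, f₀, hf₀, ?_⟩
  have hφ' : φ ∈ G.GA A (-1) 1 := Submodule.smul_le_right hφ
  have hf' : f ∈ G.GA A 0 0 := Submodule.smul_le_right hf
  have hdφ₀ : G.dbar φ₀ ∈ G.G (-1) 2 := by simpa using G.dbar_mem _ _ φ₀ hφ₀
  have hΔφ₀ : G.Δ φ₀ ∈ G.G 0 1 := by simpa using G.Δ_mem _ _ φ₀ hφ₀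
  have hdf₀ : G.dbar f₀ ∈ G.G 0 1 := by simpa using G.dbar_mem _ _ f₀ hf₀
  have hsum : (G.Δ + G.dbar) (φ₀ + f₀) = G.dbar φ₀ + (G.dbar f₀ + G.Δ φ₀) := by
    rw [LinearMap.add_apply, map_add, map_add, G.Δ_eq_zero_of_mem hf₀]
    abel
  rw [hsum] at h
  have hcl : G.classicalMC k A φ - b ⊗ₜ G.dbar φ₀ ∈ K • (⊤ : Submodule A (A ⊗[Λ] M)) := by
    have h3 := lTensor_mem_smul_top (G.projOn {(-1, 2)}) h
    rwa [map_sub, map_add, LinearMap.lTensor_tmul, map_add, map_add,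
      lTensor_eq_self (fun _ => G.projOn_eq_self (by simp)) (G.classicalMC_mem k hφ'),
      lTensor_eq_zero (fun _ => G.projOn_eq_zero (by simp)) (G.volumeMC_mem hφ' hf'),
      G.projOn_eq_self (by simp) hdφ₀, G.projOn_eq_zero (by simp) hdf₀,
      G.projOn_eq_zero (by simp) hΔφ₀, add_zero, add_zero, add_zero] at h3
  have hvol : G.volumeMC A φ f - b ⊗ₜ (G.dbar f₀ + G.Δ φ₀) ∈
      K • (⊤ : Submodule A (A ⊗[Λ] M)) := by
    have h3 := sub_mem h hcl
    rwa [TensorProduct.tmul_add, add_sub_add_comm, add_sub_cancel_left] at h3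
  have hbr : ∀ {s t : A ⊗[Λ] M}, s ∈ IsLocalRing.maximalIdeal A • (⊤ : Submodule A (A ⊗[Λ] M)) →
      t ∈ J • (⊤ : Submodule A (A ⊗[Λ] M)) →
      G.bracketA A s t ∈ K • (⊤ : Submodule A (A ⊗[Λ] M)) ∧
      G.bracketA A t s ∈ K • (⊤ : Submodule A (A ⊗[Λ] M)) := fun hs ht =>
    ⟨Submodule.smul_mono_left hKJ.maximalIdeal_mul_le (bilin_mem_mul_smul_top G.bracket hs ht),
      Submodule.smul_mono_left ((mul_comm _ _).trans_le hKJ.maximalIdeal_mul_le)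
        (bilin_mem_mul_smul_top G.bracket ht hs)⟩
  have hφm : φ ∈ IsLocalRing.maximalIdeal A • (⊤ : Submodule A (A ⊗[Λ] M)) :=
    Submodule.smul_mono le_rfl le_top hφ
  have hfm : f ∈ IsLocalRing.maximalIdeal A • (⊤ : Submodule A (A ⊗[Λ] M)) :=
    Submodule.smul_mono le_rfl le_top hf
  have hbφ : b ⊗ₜ φ₀ ∈ J • (⊤ : Submodule A (A ⊗[Λ] M)) := tmul_mem_smul_top hKJ.mem φ₀
  have hbf : b ⊗ₜ f₀ ∈ J • (⊤ : Submodule A (A ⊗[Λ] M)) := tmul_mem_smul_top hKJ.mem f₀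
  have hbφm := Submodule.smul_mono_left hJ hbφ
  constructor
  · have e : G.classicalMC k A (φ - b ⊗ₜ φ₀) = G.classicalMC k A φ - b ⊗ₜ G.dbar φ₀ +
        algebraMap k Λ (1 / 2) • (G.bracketA A (b ⊗ₜ φ₀) (b ⊗ₜ φ₀) -
          G.bracketA A φ (b ⊗ₜ φ₀) - G.bracketA A (b ⊗ₜ φ₀) φ) := by
      simp only [classicalMC, map_sub, LinearMap.sub_apply, LinearMap.lTensor_tmul, smul_sub]
      abel
    rw [e]
    exact add_mem hcl (Submodule.smul_of_tower_mem _ _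
      (sub_mem (sub_mem (hbr hbφm hbφ).1 (hbr hφm hbφ).1) (hbr hφm hbφ).2))
  · have e : G.volumeMC A (φ - b ⊗ₜ φ₀) (f - b ⊗ₜ f₀) =
        G.volumeMC A φ f - b ⊗ₜ (G.dbar f₀ + G.Δ φ₀) +
        (G.bracketA A (b ⊗ₜ φ₀) (b ⊗ₜ f₀) -
          G.bracketA A φ (b ⊗ₜ f₀) - G.bracketA A (b ⊗ₜ φ₀) f) := by
      simp only [volumeMC, map_sub, LinearMap.sub_apply, LinearMap.lTensor_tmul,
        TensorProduct.tmul_add]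
      abel
    rw [e]
    exact add_mem hvol (sub_mem (sub_mem (hbr hbφm hbf).1 (hbr hφm hbf).1) (hbr hfm hbφ).2)

theorem exists_mem_smul_rTensor_eq {A B : ArtAlg Λ} (g : A ⟶ B)
    (hg : Function.Surjective g.toAlgHom) {p q : ℤ} {x : B ⊗[Λ] M}
    (hx : x ∈ IsLocalRing.maximalIdeal B • G.GA B p q) :
    ∃ z ∈ IsLocalRing.maximalIdeal A • G.GA A p q,
      g.toAlgHom.toLinearMap.rTensor M z = x := by
  have hadd : ∀ x x' : B ⊗[Λ] M,
      (∃ z ∈ IsLocalRing.maximalIdeal A • G.GA A p q,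
        g.toAlgHom.toLinearMap.rTensor M z = x) →
      (∃ z ∈ IsLocalRing.maximalIdeal A • G.GA A p q,
        g.toAlgHom.toLinearMap.rTensor M z = x') →
      ∃ z ∈ IsLocalRing.maximalIdeal A • G.GA A p q,
        g.toAlgHom.toLinearMap.rTensor M z = x + x' := by
    rintro _ _ ⟨z, hz, rfl⟩ ⟨z', hz', rfl⟩
    exact ⟨z + z', add_mem hz hz', map_add _ _ _⟩
  refine Submodule.smul_induction_on hx (fun c hc t ht => ?_) hadd
  refine baseChange_induction (motive := fun t => ∃ z ∈ IsLocalRing.maximalIdeal A • G.GA A p q,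
      g.toAlgHom.toLinearMap.rTensor M z = c • t)
    ⟨0, zero_mem _, by rw [map_zero, smul_zero]⟩ (fun b m hm => ?_)
    (fun s s' hs hs' => by rw [smul_add]; exact hadd _ _ hs hs') ht
  obtain ⟨a, rfl⟩ := hg c
  obtain ⟨a', rfl⟩ := hg b
  refine ⟨a • (a' ⊗ₜ m), Submodule.smul_mem_smul ?_
    (Submodule.tmul_mem_baseChange_of_mem _ hm), ?_⟩
  · rw [IsLocalRing.mem_maximalIdeal] at hc ⊢
    exact fun ha => hc (ha.map g.toAlgHom)
  · rw [rTensor_smul, LinearMap.rTensor_tmul, AlgHom.toLinearMap_apply]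

theorem map_classicalMC (k : Type v) [Field k] [Algebra k Λ] {A B : Type u} [CommRing A]
    [Algebra Λ A] [CommRing B] [Algebra Λ B] (g : A →ₐ[Λ] B) (φ : A ⊗[Λ] M) :
    g.toLinearMap.rTensor M (G.classicalMC k A φ) =
      G.classicalMC k B (g.toLinearMap.rTensor M φ) := by
  simp [classicalMC, rTensor_lTensor, map_bracketA]

theorem map_volumeMC {A B : Type u} [CommRing A] [Algebra Λ A] [CommRing B] [Algebra Λ B]
    (g : A →ₐ[Λ] B) (φ f : A ⊗[Λ] M) :
    g.toLinearMap.rTensor M (G.volumeMC A φ f) =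
      G.volumeMC B (g.toLinearMap.rTensor M φ) (g.toLinearMap.rTensor M f) := by
  simp [volumeMC, rTensor_lTensor, map_bracketA]

/-- Solutions of the semi-classical Maurer–Cartan equations lift along surjections. -/
theorem exists_mem_smcSet_rTensor_eq (k : Type v) [Field k] [CharZero k] [Algebra k Λ]
    (hG : G.IsSemiPerfect) {A B : ArtAlg Λ} (g : A ⟶ B) (hg : Function.Surjective g.toAlgHom)
    {x : (B ⊗[Λ] M) × (B ⊗[Λ] M)} (hx : x ∈ G.smcSet k B) :
    ∃ z ∈ G.smcSet k A, (g.toAlgHom.toLinearMap.rTensor M z.1,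
      g.toAlgHom.toLinearMap.rTensor M z.2) = x := by
  obtain ⟨ψ, e⟩ := x
  obtain ⟨hψ, he, hMC, hvol⟩ := hx
  change G.classicalMC k B ψ = 0 at hMC
  change G.volumeMC B ψ e = 0 at hvol
  obtain ⟨J, ⟨hJg, φ, f, hφ, hf, hφψ, hfe, h1, h2⟩, hmin⟩ :=
    (wellFounded_lt (α := Ideal A)).has_min
    {J | J ≤ RingHom.ker g.toAlgHom ∧ ∃ φ f : A ⊗[Λ] M,
      φ ∈ IsLocalRing.maximalIdeal A • G.GA A (-1) 1 ∧
      f ∈ IsLocalRing.maximalIdeal A • G.GA A 0 0 ∧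
      g.toAlgHom.toLinearMap.rTensor M φ = ψ ∧ g.toAlgHom.toLinearMap.rTensor M f = e ∧
      G.classicalMC k A φ ∈ J • (⊤ : Submodule A (A ⊗[Λ] M)) ∧
      G.volumeMC A φ f ∈ J • (⊤ : Submodule A (A ⊗[Λ] M))} (by
    obtain ⟨φ, hφ, rfl⟩ := G.exists_mem_smul_rTensor_eq g hg hψ
    obtain ⟨f, hf, rfl⟩ := G.exists_mem_smul_rTensor_eq g hg he
    refine ⟨_, le_rfl, φ, f, hφ, hf, rfl, rfl, ?_, ?_⟩
    · rw [← ker_rTensor_eq_smul_top _ hg, map_classicalMC, hMC]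
    · rw [← ker_rTensor_eq_smul_top _ hg, map_volumeMC, hvol])
  rcases (bot_le : ⊥ ≤ J).eq_or_lt with rfl | hlt
  · rw [Submodule.bot_smul, Submodule.mem_bot] at h1 h2
    exact ⟨(φ, f), ⟨hφ, hf, h1, h2⟩, by rw [hφψ, hfe]⟩
  exfalso
  obtain ⟨K, b, -, hKJ⟩ := exists_isSimpleStep hlt
  have hJ : J ≤ IsLocalRing.maximalIdeal A :=
    hJg.trans (IsLocalRing.le_maximalIdeal (RingHom.ker_ne_top _))
  obtain ⟨φ₀, hφ₀, f₀, hf₀, h1', h2'⟩ := G.exists_correction k hG hKJ hJ hφ hf h1 h2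
  have hb : ∀ m : M, b ⊗ₜ[Λ] m = b • ((1 : A) ⊗ₜ[Λ] m) := fun m => by
    rw [TensorProduct.smul_tmul', smul_eq_mul, mul_one]
  have hbg : ∀ m : M, g.toAlgHom.toLinearMap.rTensor M (b ⊗ₜ m) = 0 := fun m => by
    rw [LinearMap.rTensor_tmul, AlgHom.toLinearMap_apply, (RingHom.mem_ker).1 (hJg hKJ.mem),
      TensorProduct.zero_tmul]
  refine hmin K ⟨hKJ.le.trans hJg, φ - b ⊗ₜ φ₀, f - b ⊗ₜ f₀, sub_mem hφ ?_, sub_mem hf ?_, ?_, ?_,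
    h1', h2'⟩ hKJ.lt
  · rw [hb]
    exact Submodule.smul_mem_smul (hJ hKJ.mem) (Submodule.tmul_mem_baseChange_of_mem _ hφ₀)
  · rw [hb]
    exact Submodule.smul_mem_smul (hJ hKJ.mem) (Submodule.tmul_mem_baseChange_of_mem _ hf₀)
  · rw [map_sub, hbg, sub_zero, hφψ]
  · rw [map_sub, hbg, sub_zero, hfe]

theorem IsSemiPerfect.unobstructed (k : Type v) [Field k] [CharZero k] [Algebra k Λ]
    {G : CurvedBVAlgebra Λ d M} (hG : G.IsSemiPerfect) : Unobstructed (G.SMC k) := by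
  intro A B g hg x
  obtain ⟨z, hz, hzx⟩ := G.exists_mem_smcSet_rTensor_eq k hG g hg x.2
  exact ⟨⟨z, hz⟩, Subtype.ext hzx⟩

theorem IsQuasiPerfect.isSemiPerfect {G : CurvedBVAlgebra Λ d M} (hG : G.IsQuasiPerfect) :
    G.IsSemiPerfect :=
  ⟨hG.degenerates 0, fun A => hG.surjective A 0⟩

end CurvedBVAlgebra

end BVUnobstructed

theorem mainTheorem3 (k : Type v) [Field k] [CharZero k]
    (Λ : Type u) [CommRing Λ] [IsLocalRing Λ] [IsNoetherianRing Λ]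
    [IsAdicComplete (IsLocalRing.maximalIdeal Λ) Λ] [Algebra k Λ]
    (hk : Function.Bijective (algebraMap k (IsLocalRing.ResidueField Λ)))
    (d : ℕ) (hd : 1 ≤ d) (M : Type w) [AddCommGroup M] [Module Λ M]
    (G : BVUnobstructed.CurvedBVAlgebra Λ d M) :
    (G.IsQuasiPerfect → BVUnobstructed.Unobstructed (G.SMC k)) ∧
    (G.IsQuasiPerfect → G.IsSemiPerfect) ∧
    (G.IsSemiPerfect → BVUnobstructed.Unobstructed (G.SMC k)) :=
  ⟨fun h => h.isSemiPerfect.unobstructed k, fun h => h.isSemiPerfect, fun h => h.unobstructed k⟩
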